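/- Let $H$ be a separable complex Hilbert space, $\varepsilon>0$, and let $P=(P_j)_{j\in J}$ be a finite family of commuting (possibly unbounded) self-adjoint operators in $H$ with joint spectral measure $E$ on $\mathbb R^J$, so that $m(P)=\int m\,dE$ for bounded Borel $m$. Let $\mathfrak H=\bigoplus_{n\ge0}H_+^{(n)}$ be the boson Fock space over $H$, with the vector annihilation operator $\hat a$; its component $\hat a(f)=\langle f,\hat a\rangle$ along $f\in H$ maps $H_+^{(n+1)}$ to $H_+^{(n)}$ and is $\sqrt{n+1}$ times the contraction of one tensor factor with $f$. Let $\hat a^*P_j\hat a$ be the second quantization of $P_j$. For each time $t$ let $W^{(m)}(t)$, $m\ge1$, be Hermitian permutation-symmetric operators in $H^{\otimes m}$, defined on the algebraic tensor powers of a dense subspace $\Phi\subset H$, and let $$\hat H(t)=\tfrac1\varepsilon\gamma(t,\varepsilon \hat a\hat a^*)=\sum_{m\ge1}\frac{\varepsilon^{m-1}}{m!}\,\hat a^{*\otimes m}W^{(m)}(t)\,\hat a^{\otimes m},\qquad \hat H(t)|_{H_+^{(n)}}=\sum_{m=1}^n\binom nm\varepsilon^{m-1}I^{(n-m)}\otimes_sW^{(m)}(t),$$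 be the (closed) uniformized Hamiltonian, where $\gamma(t,\rho)=\sum_m\frac1{m!}\langle\rho^{\otimes m},W^{(m)}(t)\rangle$. Let $U(t)$, $U(t_0)=1$, be a unitary evolution generated by it ($i\,\partial_tU(t)y=\hat H(t)U(t)y$ for all $t$ and all $y$ in a dense set), and $\hat a(t)=U(t)^{-1}\hat a\,U(t)$. Let $d\mathbf p$ be a $\sigma$-finite Borel measure on $\mathbb R^J$ (discrete or continuous), and let $|\mathbf p\rangle$, $\mathbf p=(p_j)\in\mathbb R^J$, be generalized vectors whose wave packets $\int g(\mathbf p)|\mathbf p\rangle d\mathbf p$, with $g$ bounded and measurable with bounded support of finite measure, belong to $\mathfrak H$. Suppose that they are joint generalized eigenvectors (i.e. weakly, on wave packets) of the operators $\varepsilon\hat a^*P_j\hat a$, with the eigenvalues $p_j$, and of $\gamma(t,\varepsilon\hat a\hat a^*)=\varepsilon\hat H(t)$, with the eigenvalues $h(t,\mathbf p)$, for every $t$, where $h:\mathbb R\times\mathbb R^J\to\mathbb R$ is bounded on bounded sets, continuous in $t$ and measurable in $\mathbf p$. The matrix elements $\langle\mathbf p|\hat a(t)|\mathbf p'\rangle$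 are understood as integral kernels: componentwise, for each $f\in H$, $\langle\mathbf p|\hat a(f)(t)|\mathbf p'\rangle$ is the function, if there is one, which represents the form of $\hat a(f)(t)$ on wave packets, integrably for each pair of wave packets. Suppose that the vectors $$\psi_{\mathbf p}(t)=\sqrt\varepsilon\int\langle\mathbf p|\hat a(t)|\mathbf p'\rangle\,d\mathbf p'\in H$$ (the integral is taken weakly in $H$, i.e. for the components along each $f\in H$, and absolutely convergent for almost all $\mathbf p$) exist at $t=t_0$, and put $\varphi_{\mathbf p}=\psi_{\mathbf p}(t_0)$. Then they exist for every $t$, and for every $t$ and almost every $\mathbf p$ $$\psi_{\mathbf p}(t)=\exp\Big\{-\frac i\varepsilon\int_{t_0}^t\big(h(s,\mathbf p+\varepsilon P)-h(s,\mathbf p)\big)ds\Big\}\varphi_{\mathbf p},$$ where the exponential is the function $k\mapsto\exp\{-\frac i\varepsilon\int_{t_0}^t(h(s,\mathbf p+\varepsilon k)-h(s,\mathbf p))ds\}$ of the commuting operators $P$. -/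

import Mathlib

open MeasureTheory Filter Topology
open scoped ENNReal

noncomputable section

/-! ### Projection-valued measures and their bounded functional calculus -/

/-- A projection-valued measure on `X` with values in the orthogonal projections of `H`. -/
structure ProjectionValuedMeasure (X H : Type*) [MeasurableSpace X] [NormedAddCommGroup H]
    [InnerProductSpace ℂ H] [CompleteSpace H] where
  proj : Set X → H →L[ℂ] H
  isStarProjection : ∀ A, MeasurableSet A → IsStarProjection (proj A)
  proj_univ : proj Set.univ = 1
  proj_inter : ∀ A B, MeasurableSet A → MeasurableSet B → proj (A ∩ B) = proj A * proj B
  hasSum_iUnion : ∀ A : ℕ → Set X, (∀ n, MeasurableSet (A n)) →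
    Pairwise (Function.onFun Disjoint A) →
    ∀ x, HasSum (fun n => proj (A n) x) (proj (⋃ n, A n) x)

namespace ProjectionValuedMeasure

variable {X H : Type*} [MeasurableSpace X] [NormedAddCommGroup H]
  [InnerProductSpace ℂ H] [CompleteSpace H]

theorem proj_empty (E : ProjectionValuedMeasure X H) : E.proj ∅ = 0 := by
  ext x
  have h := E.hasSum_iUnion (fun _ => ∅) (fun _ => MeasurableSet.empty)
    (fun _ _ _ => by simp [Function.onFun]) x
  have h2 := h.summable
  rw [summable_const_iff] at h2
  simpa using h2

theorem inner_proj (E : ProjectionValuedMeasure X H) {A : Set X} (hA : MeasurableSet A) (x : H) :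
    inner ℂ x (E.proj A x) = ((‖E.proj A x‖ ^ 2 : ℝ) : ℂ) := by
  have h := E.isStarProjection A hA
  have h1 : E.proj A (E.proj A x) = E.proj A x := by
    have := congrArg (fun T : H →L[ℂ] H => T x) h.isIdempotentElem.eq
    simpa using this
  have h2 : (E.proj A).adjoint = E.proj A := by
    have := h.isSelfAdjoint.star_eq
    rwa [ContinuousLinearMap.star_eq_adjoint] at this
  have h3 : inner ℂ x (E.proj A x) = inner ℂ (E.proj A x) (E.proj A x) := by
    conv_lhs => rw [← h1]
    rw [← ContinuousLinearMap.adjoint_inner_left, h2]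
  rw [h3, inner_self_eq_norm_sq_to_K]
  norm_cast

/-- The scalar spectral measure `A ↦ ⟨x, E(A) x⟩ = ‖E(A) x‖ ^ 2` of a vector `x`. -/
def measure (E : ProjectionValuedMeasure X H) (x : H) : Measure X :=
  Measure.ofMeasurable (fun A _ => ENNReal.ofReal (‖E.proj A x‖ ^ 2))
    (by simp [E.proj_empty])
    (by
      intro A hA hd
      have h := (E.hasSum_iUnion A hA hd x).mapL (innerSL ℂ x)
      simp only [innerSL_apply_apply] at h
      rw [E.inner_proj (MeasurableSet.iUnion hA)] at h
      have h' : HasSum (fun n => ((‖E.proj (A n) x‖ ^ 2 : ℝ) : ℂ))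
          ((‖E.proj (⋃ i, A i) x‖ ^ 2 : ℝ) : ℂ) := by
        refine h.congr_fun ?_ 
        intro n
        exact (E.inner_proj (hA n) x).symm
      rw [Complex.hasSum_ofReal] at h'
      rw [← h'.tsum_eq]
      exact ENNReal.ofReal_tsum_of_nonneg (fun n => by positivity) h'.summable)

theorem measure_apply (E : ProjectionValuedMeasure X H) (x : H) {A : Set X}
    (hA : MeasurableSet A) : E.measure x A = ENNReal.ofReal (‖E.proj A x‖ ^ 2) :=
  Measure.ofMeasurable_apply A hA

theorem measure_univ (E : ProjectionValuedMeasure X H) (x : H) :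
    E.measure x Set.univ = ENNReal.ofReal (‖x‖ ^ 2) := by
  rw [E.measure_apply x MeasurableSet.univ, E.proj_univ]; simp

instance (E : ProjectionValuedMeasure X H) (x : H) : IsFiniteMeasure (E.measure x) :=
  ⟨by rw [E.measure_univ]; exact ENNReal.ofReal_lt_top⟩

theorem exists_weak_limit (T : ℕ → H →L[ℂ] H) (q : H → ℂ) {C : ℝ} (hC : 0 ≤ C)
    (hb : ∀ n x, ‖inner ℂ x (T n x)‖ ≤ C * ‖x‖ ^ 2)
    (hq : ∀ x, Tendsto (fun n => inner ℂ x (T n x)) atTop (𝓝 (q x))) :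
    ∃ S : H →L[ℂ] H, ∀ x, inner ℂ x (S x) = q x := by
  have hb' : ∀ n x, ‖inner ℂ (T n x) x‖ ≤ C * ‖x‖ ^ 2 := fun n x => by
    rw [norm_inner_symm]; exact hb n x
  have hq' : ∀ x, Tendsto (fun n => inner ℂ (T n x) x) atTop (𝓝 (starRingEnd ℂ (q x))) := by
    intro x
    have := (Complex.continuous_conj.tendsto _).comp (hq x)
    refine this.congr fun n => ?_
    simp [Function.comp]
  have hpol := fun n (x y : H) => inner_map_polarization' (T n : H →ₗ[ℂ] H) x y
  simp only [ContinuousLinearMap.coe_coe] at hpol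
  have hex : ∀ x y, ∃ c, Tendsto (fun n => inner ℂ (T n x) y) atTop (𝓝 c) := by
    intro x y
    exact ⟨_, (((((hq' _).sub (hq' _)).sub ((hq' _).const_mul _)).add
      ((hq' _).const_mul _)).div_const 4).congr fun n => (hpol n x y).symm⟩
  choose B hB using hex
  let l : H → H →L[ℂ] ℂ := fun x =>
    continuousLinearMapOfTendsto (fun n => innerSL ℂ (T n x)) (f := B x)
      (tendsto_pi_nhds.2 fun y => by simpa using hB x y)
  have hl : ∀ x y, inner ℂ ((InnerProductSpace.toDual ℂ H).symm (l x)) y = B x y := by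
    intro x y
    rw [InnerProductSpace.toDual_symm_apply]
    rfl
  let S0 : H →ₗ[ℂ] H :=
    { toFun := fun x => (InnerProductSpace.toDual ℂ H).symm (l x)
      map_add' := by
        intro x y
        refine ext_inner_right ℂ fun z => ?_
        rw [inner_add_left, hl, hl, hl]
        refine tendsto_nhds_unique (hB _ _) (((hB x z).add (hB y z)).congr fun n => ?_)
        rw [map_add, inner_add_left]
      map_smul' := by
        intro c x
        refine ext_inner_right ℂ fun z => ?_
        rw [RingHom.id_apply, inner_smul_left, hl, hl]
        refine tendsto_nhds_unique (hB _ _) (((hB x z).const_mul _).congr fun n => ?_)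
        rw [map_smul, inner_smul_left] }
  have hS0 : ∀ x y, inner ℂ (S0 x) y = B x y := hl
  have hbound : ∀ x y, ‖B x y‖ ≤ C * (2 * ‖x‖ ^ 2 + 2 * ‖y‖ ^ 2) := by
    intro x y
    refine le_of_tendsto (hB x y).norm (Eventually.of_forall fun n => ?_)
    rw [hpol n x y, norm_div]
    have p1 := parallelogram_law_with_norm ℂ x y
    have p2 := parallelogram_law_with_norm ℂ x (Complex.I • y)
    rw [norm_smul, Complex.norm_I, one_mul] at p2
    have e1 := hb' n (x + y)
    have e2 := hb' n (x - y)
    have e3 := hb' n (x + Complex.I • y)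
    have e4 := hb' n (x - Complex.I • y)
    have t : ∀ a b c d : ℂ, ‖a - b - Complex.I * c + Complex.I * d‖ ≤
        ‖a‖ + ‖b‖ + ‖c‖ + ‖d‖ := by
      intro a b c d
      refine (norm_add_le _ _).trans ?_
      have h1 := norm_sub_le (a - b) (Complex.I * c)
      have h2 := norm_sub_le a b
      rw [norm_mul, Complex.norm_I, one_mul] at h1
      rw [norm_mul, Complex.norm_I, one_mul]
      linarith
    have h4 : ‖(4 : ℂ)‖ = 4 := by simp
    rw [h4, div_le_iff₀ (by norm_num)]
    refine (t _ _ _ _).trans ?_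
    have q1 : C * ‖x + y‖ ^ 2 + C * ‖x - y‖ ^ 2 = C * (2 * (‖x‖ ^ 2 + ‖y‖ ^ 2)) := by
      rw [← mul_add]; congr 1
    have q2 : C * ‖x + Complex.I • y‖ ^ 2 + C * ‖x - Complex.I • y‖ ^ 2
        = C * (2 * (‖x‖ ^ 2 + ‖y‖ ^ 2)) := by
      rw [← mul_add]; congr 1
    nlinarith [mul_nonneg hC (sq_nonneg ‖x‖), mul_nonneg hC (sq_nonneg ‖y‖)]
  refine ⟨S0.mkContinuous (4 * C) ?_, ?_⟩
  · intro x
    rcases eq_or_ne (S0 x) 0 with h0 | h0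
    · rw [h0, norm_zero]; positivity
    rcases eq_or_ne x 0 with hx | hx
    · subst hx; simp
    have h := hbound x (((‖x‖ / ‖S0 x‖ : ℝ) : ℂ) • S0 x)
    have hn : ‖S0 x‖ ≠ 0 := norm_ne_zero_iff.2 h0
    have hxp : 0 < ‖x‖ := norm_pos_iff.2 hx
    have e : ‖((‖x‖ / ‖S0 x‖ : ℝ) : ℂ) • S0 x‖ = ‖x‖ := by
      rw [norm_smul, Complex.norm_real, Real.norm_of_nonneg (by positivity)]
      field_simp
    rw [← hS0, inner_smul_right, inner_self_eq_norm_sq_to_K, norm_mul, e] at h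
    rw [Complex.norm_real, Real.norm_of_nonneg (by positivity), norm_pow] at h
    have e2 : ‖((‖S0 x‖ : ℝ) : ℂ)‖ = ‖S0 x‖ := by simp
    have h' : ‖x‖ / ‖S0 x‖ * ‖S0 x‖ ^ 2 ≤ C * (2 * ‖x‖ ^ 2 + 2 * ‖x‖ ^ 2) := by
      simpa using h
    have e3 : ‖x‖ / ‖S0 x‖ * ‖S0 x‖ ^ 2 = ‖x‖ * ‖S0 x‖ := by field_simp
    rw [e3] at h'
    have h5 : ‖x‖ * ‖S0 x‖ ≤ ‖x‖ * (4 * C * ‖x‖) := by nlinarith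
    exact le_of_mul_le_mul_left h5 hxp
  · intro x
    rw [LinearMap.mkContinuous_apply, ← inner_conj_symm, hS0,
      tendsto_nhds_unique (hB x x) (hq' x), Complex.conj_conj]

theorem exists_integral (E : ProjectionValuedMeasure X H) {m : X → ℂ} (hm : Measurable m)
    {C : ℝ} (hC : ∀ k, ‖m k‖ ≤ C) :
    ∃ T : H →L[ℂ] H, ∀ x, inner ℂ x (T x) = ∫ k, m k ∂(E.measure x) := by
  have hC' : ∀ k, ‖m k‖ ≤ max C 0 := fun k => (hC k).trans (le_max_left _ _)
  have h0 : 0 ≤ max C 0 := le_max_right _ _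
  generalize max C 0 = D at hC' h0
  let s : ℕ → SimpleFunc X ℂ := hm.stronglyMeasurable.approxBounded D
  have hs : ∀ n k, ‖s n k‖ ≤ D := fun n k =>
    hm.stronglyMeasurable.norm_approxBounded_le h0 n k
  have hsi : ∀ n x, Integrable (s n) (E.measure x) := fun n x =>
    Integrable.of_bound (s n).aestronglyMeasurable D (Eventually.of_forall (hs n))
  let T : ℕ → H →L[ℂ] H := fun n => ∑ c ∈ (s n).range, c • E.proj (s n ⁻¹' {c})
  have hT : ∀ n x, inner ℂ x (T n x) = ∫ k, s n k ∂(E.measure x) := by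
    intro n x
    rw [← SimpleFunc.integral_eq_integral _ (hsi n x), SimpleFunc.integral_eq]
    simp only [T, sum_apply, inner_sum]
    refine Finset.sum_congr rfl fun c _ => ?_
    rw [smul_apply, inner_smul_right,
      E.inner_proj ((s n).measurableSet_fiber c), Measure.real,
      E.measure_apply x ((s n).measurableSet_fiber c), ENNReal.toReal_ofReal (by positivity),
      Complex.real_smul, mul_comm]
  refine exists_weak_limit T _ h0 ?_ ?_
  · intro n x
    rw [hT]
    refine (norm_integral_le_of_norm_le_const (Eventually.of_forall (hs n))).trans ?_
    rw [Measure.real, E.measure_univ, ENNReal.toReal_ofReal (by positivity)]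
  · intro x
    simp only [hT]
    refine tendsto_integral_of_dominated_convergence (fun _ => D)
      (fun n => (s n).aestronglyMeasurable) (integrable_const D)
      (fun n => Eventually.of_forall (hs n)) (Eventually.of_forall fun k => ?_)
    exact StronglyMeasurable.tendsto_approxBounded_of_norm_le hm.stronglyMeasurable (hC' k)

open Classical in
/-- The bounded operator `m(P) = ∫ m dE`, for a bounded measurable function `m`: the (unique)
operator `T` with `⟨x, T x⟩ = ∫ m d⟨x, E x⟩` for all `x`. -/
def integral (E : ProjectionValuedMeasure X H) (m : X → ℂ) : H →L[ℂ] H :=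
  if h : ∃ T : H →L[ℂ] H, ∀ x, inner ℂ x (T x) = ∫ k, m k ∂(E.measure x) then h.choose else 0

theorem inner_integral (E : ProjectionValuedMeasure X H) {m : X → ℂ} (hm : Measurable m)
    {C : ℝ} (hC : ∀ k, ‖m k‖ ≤ C) (x : H) :
    inner ℂ x (E.integral m x) = ∫ k, m k ∂(E.measure x) := by
  have h := E.exists_integral hm hC
  rw [integral, dif_pos h]
  exact h.choose_spec x

end ProjectionValuedMeasure

/-- `E` is the joint spectral measure of the family `P` of (possibly unbounded) operators:
`P j = ∫ k j dE(k)` for every `j`, with the maximal domain. By the spectral theorem, the families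
which have a joint spectral measure are the families of commuting self-adjoint operators. -/
structure IsJointSpectralMeasure {J H : Type*} [NormedAddCommGroup H] [InnerProductSpace ℂ H]
    [CompleteSpace H] (P : J → H →ₗ.[ℂ] H) (E : ProjectionValuedMeasure (J → ℝ) H) : Prop where
  mem_domain_iff : ∀ j x, x ∈ (P j).domain ↔ Integrable (fun k => (k j) ^ 2) (E.measure x)
  inner_apply : ∀ j (x : (P j).domain),
    inner ℂ (x : H) (P j x) = ((∫ k, k j ∂(E.measure (x : H)) : ℝ) : ℂ)

/-! ### The Fock space

With respect to an orthonormal basis indexed by `ι`, an `n`-particle tensor is the family of its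
coordinates, indexed by the lists of length `n` in `ι`; so the full Fock space is `ℓ²(List ι)`. -/

/-- The full (unsymmetrized) Fock space `⨁ₙ H^{⊗n}`. -/
abbrev FullFock (ι : Type*) := lp (fun _ : List ι => ℂ) 2

/-- The boson Fock space `⨁ₙ H₊⁽ⁿ⁾`: the tensors which are invariant under permutations. -/
def Fock (ι : Type*) : Submodule ℂ (FullFock ι) where
  carrier := {x | ∀ l l' : List ι, l.Perm l' → x l = x l'}
  zero_mem' := fun _ _ _ => rfl
  add_mem' := by
    intro x y hx hy l l' h
    simp only [lp.coeFn_add, Pi.add_apply, hx l l' h, hy l l' h]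
  smul_mem' := by
    intro c x hx l l' h
    simp only [lp.coeFn_smul, Pi.smul_apply, hx l l' h]

theorem isClosed_fock (ι : Type*) : IsClosed (Fock ι : Set (FullFock ι)) := by
  have hc : ∀ l : List ι, Continuous fun x : FullFock ι => x l := fun l =>
    (continuous_apply l).comp (lp.uniformContinuous_coe (p := 2)).continuous
  have : (Fock ι : Set (FullFock ι)) =
      ⋂ (l : List ι) (l' : List ι) (_ : l.Perm l'), {x : FullFock ι | x l = x l'} := by
    ext x
    simp only [Set.mem_iInter]
    exact Iff.rfl
  rw [this]
  exact isClosed_iInter fun l => isClosed_iInter fun l' => isClosed_iInter fun _ =>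
    isClosed_eq (hc l) (hc l')

instance (ι : Type*) : CompleteSpace (Fock ι) := (isClosed_fock ι).completeSpace_coe

/-- The symmetrization: the orthogonal projection onto the symmetric tensors. -/
def symmetrize {ι : Type*} (x : FullFock ι) : Fock ι := (Fock ι).orthogonalProjectionOnto x

theorem memℓp_two_of_mul {α β γ : Type*} {f : α → ℂ} {g : β → ℂ} (hf : Memℓp f 2)
    (hg : Memℓp g 2) (e : γ → α × β) (he : Function.Injective e) :
    Memℓp (fun c => f (e c).1 * g (e c).2) 2 := by
  have h2 : 0 < (2 : ℝ≥0∞).toReal := by norm_num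
  rw [memℓp_gen_iff h2] at hf hg ⊢
  have := (hf.mul_of_nonneg hg (fun _ => by positivity) (fun _ => by positivity)).comp_injective he
  refine this.congr fun c => ?_
  simp [Function.comp, mul_pow]

section Tensors

variable {ι H : Type*} [NormedAddCommGroup H] [InnerProductSpace ℂ H] (b : HilbertBasis ι ℂ H)

/-- The coordinates of the elementary tensor `f₁ ⊗ ⋯ ⊗ fₙ`. -/
def tensorCoord : List H → List ι → ℂ
  | [], [] => 1
  | f :: fs, i :: l => b.repr f i * tensorCoord fs l
  | [], _ :: _ => 0
  | _ :: _, [] => 0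

theorem memℓp_tensorCoord (fs : List H) : Memℓp (tensorCoord b fs) 2 := by
  have h2 : 0 < (2 : ℝ≥0∞).toReal := by norm_num
  induction fs with
  | nil =>
    rw [memℓp_gen_iff h2]
    refine summable_of_ne_finset_zero (s := {[]}) ?_
    intro l hl
    cases l with
    | nil => simp at hl
    | cons i l => simp [tensorCoord]
  | cons f fs ih =>
    have h := memℓp_two_of_mul (b.repr f).2 ih (fun c : ι × List ι => c) Function.injective_id
    rw [memℓp_gen_iff h2] at h ⊢
    have hinj : Function.Injective fun c : ι × List ι => c.1 :: c.2 := by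
      rintro ⟨i, l⟩ ⟨i', l'⟩ h
      simpa using h
    rw [← hinj.summable_iff]
    · exact h
    · intro l hl
      cases l with
      | nil => simp [tensorCoord]
      | cons i l => exact absurd ⟨(i, l), rfl⟩ hl

/-- The elementary tensor `f₁ ⊗ ⋯ ⊗ fₙ`. -/
def tensor (fs : List H) : FullFock ι := ⟨tensorCoord b fs, memℓp_tensorCoord b fs⟩

theorem tensorCoord_replicate (f : H) (n : ℕ) (l : List ι) :
    tensorCoord b (List.replicate n f) l =
      if l.length = n then (l.map fun i => b.repr f i).prod else 0 := by
  induction n generalizing l with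
  | zero => cases l <;> simp [tensorCoord]
  | succ n ih =>
    cases l with
    | nil => simp [tensorCoord, List.replicate_succ]
    | cons i l => simp [tensorCoord, List.replicate_succ, ih]

/-- The tensor power `φ^{⊗n}`. -/
def tensorPow (n : ℕ) (φ : H) : Fock ι :=
  ⟨tensor b (List.replicate n φ), by
    intro l l' h
    change tensorCoord b _ l = tensorCoord b _ l'
    rw [tensorCoord_replicate, tensorCoord_replicate, h.length_eq, (h.map _).prod_eq]⟩

theorem memℓp_tmul (k : ℕ) {f g : List ι → ℂ} (hf : Memℓp f 2) (hg : Memℓp g 2) :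
    Memℓp (fun l : List ι => f (l.take k) * g (l.drop k)) 2 := by
  refine memℓp_two_of_mul hf hg (fun l : List ι => (l.take k, l.drop k)) ?_
  intro l l' h
  have h1 : l.take k = l'.take k := congrArg Prod.fst h
  have h2 : l.drop k = l'.drop k := congrArg Prod.snd h
  calc l = l.take k ++ l.drop k := (List.take_append_drop k l).symm
    _ = l'.take k ++ l'.drop k := by rw [h1, h2]
    _ = l' := List.take_append_drop k l'

/-- The tensor product `x ⊗ y` of a `k`-particle tensor `x` with a tensor `y`. -/
def tmul (k : ℕ) (x y : FullFock ι) : FullFock ι :=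
  ⟨fun l => x (l.take k) * y (l.drop k), memℓp_tmul k x.2 y.2⟩

/-- A symmetric `m`-particle operator `W` (possibly unbounded), defined on the algebraic
`m`-th tensor power of the subspace `Φ` of `H`, i.e. as a multilinear map with values in
`H^{⊗m}`, which is Hermitian and commutes with the permutations of the particles. -/
structure ParticleOperator (Φ : Submodule ℂ H) (m : ℕ) where
  toMap : MultilinearMap ℂ (fun _ : Fin m => Φ) (FullFock ι)
  graded : ∀ φ l, l.length ≠ m → toMap φ l = 0
  hermitian : ∀ φ ψ : Fin m → Φ,
    inner ℂ (tensor b (List.ofFn fun i => (ψ i : H))) (toMap φ) =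
      inner ℂ (toMap ψ) (tensor b (List.ofFn fun i => (φ i : H)))
  symmetric : ∀ (σ : Equiv.Perm (Fin m)) (φ : Fin m → Φ) (c : Fin m → ι),
    toMap (φ ∘ σ) (List.ofFn (c ∘ σ)) = toMap φ (List.ofFn c)

/-- The vector `H⁽ⁿ⁾ φ^{⊗n}`, where
`H⁽ⁿ⁾ = ∑_{1 ≤ m ≤ n} (n choose m) ε^{m-1} I^{(n-m)} ⊗ₛ W⁽ᵐ⁾`. -/
def uniformizedApply {Φ : Submodule ℂ H} (ε : ℝ) (W : ∀ m, ParticleOperator b Φ m)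
    (n : ℕ) (φ : Φ) : Fock ι :=
  ∑ m ∈ Finset.Icc 1 n, ((n.choose m : ℂ) * (ε : ℂ) ^ (m - 1)) •
    symmetrize (tmul (n - m) (tensorPow b (n - m) (φ : H) : Fock ι) ((W m).toMap fun _ => φ))

/-- The graph of the uniformized Hamiltonian
`Ĥ = (1/ε) γ(ε a a*) = ∑ₘ (ε^{m-1}/m!) a*^{⊗m} W⁽ᵐ⁾ a^{⊗m} = ⨁ₙ H⁽ⁿ⁾` on the boson Fock space:
the closure of the operator on the span of the `φ^{⊗n}`, `φ ∈ Φ`. -/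
def uniformizedHamiltonian {Φ : Submodule ℂ H} (ε : ℝ) (W : ∀ m, ParticleOperator b Φ m) :
    Submodule ℂ (Fock ι × Fock ι) :=
  (Submodule.span ℂ {z | ∃ (n : ℕ) (φ : Φ),
    z = (tensorPow b n (φ : H), uniformizedApply b ε W n φ)}).topologicalClosure

/-- The graph of the second quantization `a* P a = ⨁ₙ n I^{(n-1)} ⊗ₛ P` of a one-particle
operator `P`: the closure of the operator on the span of the `φ^{⊗n}`, `φ ∈ dom P`. -/
def secondQuantization (P : H →ₗ.[ℂ] H) : Submodule ℂ (Fock ι × Fock ι) :=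
  (Submodule.span ℂ {z | ∃ (n : ℕ) (φ : P.domain),
    z = (tensorPow b n (φ : H),
      (n : ℂ) • symmetrize (tmul (n - 1) (tensorPow b (n - 1) (φ : H) : Fock ι)
        (tensor b [P φ])))}).topologicalClosure

/-- The graph of `c • T`, for an operator `T` given by its graph. -/
def smulGraph (c : ℂ) (T : Submodule ℂ (Fock ι × Fock ι)) : Submodule ℂ (Fock ι × Fock ι) :=
  T.map (LinearMap.prodMap LinearMap.id (c • LinearMap.id))

/-- `y = a(f) x`, where `a(f) = ⟨f, a⟩` is the component along `f` of the vector operator of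
annihilation of bosons: `√(n+1)` times the contraction of the first factor with `f`. -/
def IsAnnihilation (f : H) (x y : Fock ι) : Prop :=
  ∀ l : List ι, (y : FullFock ι) l =
    (Real.sqrt (l.length + 1) : ℂ) * ∑' i, inner ℂ f (b i) * (x : FullFock ι) (i :: l)

/-- `y = a(f)(t) x`, with `a(f)(t) = U⁻¹ a(f) U` the Heisenberg operator of annihilation. -/
def IsHeisenbergAnnihilation (U : Fock ι ≃ₗᵢ[ℂ] Fock ι) (f : H) (x y : Fock ι) : Prop :=
  IsAnnihilation b f (U x) (U y)

end Tensors

/-- `U` is the unitary evolution `U(t, t₀)` generated by the operators with the graphs `G t`: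
`U(t₀) = 1` and `i d/dt U(t) y = G(t) U(t) y` for all `y` in a dense set. -/
def IsPropagator {ι : Type*} (G : ℝ → Submodule ℂ (Fock ι × Fock ι)) (t₀ : ℝ)
    (U : ℝ → Fock ι ≃ₗᵢ[ℂ] Fock ι) : Prop :=
  (∀ x, U t₀ x = x) ∧ ∃ Y : Set (Fock ι), Dense Y ∧ ∀ y ∈ Y, ∀ t, ∃ v,
    HasDerivAt (fun s => U s y) v t ∧ (U t y, Complex.I • v) ∈ G t

/-! ### Generalized eigenvectors -/

section Generalized

variable {J ι : Type*} [Fintype J]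

/-- Wave-packet amplitudes: bounded measurable functions of the label `p` whose support is bounded
and of finite measure. -/
structure IsAmplitude (μ : Measure (J → ℝ)) (g : (J → ℝ) → ℂ) : Prop where
  measurable : Measurable g
  bounded : ∃ C, ∀ p, ‖g p‖ ≤ C
  bounded_support : Bornology.IsBounded (Function.support g)
  finite_support : μ (Function.support g) < ⊤

/-- A family `|p⟩` of generalized vectors of the boson Fock space. Each `|p⟩` is a symmetric
tensor given by its coordinates, not necessarily square summable, but the wave packets
`∫ g(p) |p⟩ dμ(p)` are vectors of the Fock space. -/
structure KetFamily (μ : Measure (J → ℝ)) (ι : Type*) where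
  ket : (J → ℝ) → List ι → ℂ
  symmetric : ∀ p l l', l.Perm l' → ket p l = ket p l'
  integrable : ∀ g, IsAmplitude μ g → ∀ l, Integrable (fun p => g p * ket p l) μ
  memℓp : ∀ g, IsAmplitude μ g → Memℓp (fun l => ∫ p, g p * ket p l ∂μ) 2

/-- The wave packet `∫ g(p) |p⟩ dμ(p)`. -/
def KetFamily.packet {μ : Measure (J → ℝ)} (K : KetFamily μ ι) (g : {g // IsAmplitude μ g}) :
    Fock ι :=
  ⟨⟨fun l => ∫ p, g.1 p * K.ket p l ∂μ, K.memℓp g.1 g.2⟩, by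
    intro l l' h
    change ∫ p, g.1 p * K.ket p l ∂μ = ∫ p, g.1 p * K.ket p l' ∂μ
    simp only [K.symmetric _ l l' h]⟩

/-- The `|p⟩` are generalized eigenvectors, with the eigenvalues `lam p`, of the operator with the
graph `T`: `⟨T x | p⟩ = lam p ⟨x | p⟩` for all `x ∈ dom T`, in the sense of wave packets. -/
def KetFamily.IsGeneralizedEigenfamily {μ : Measure (J → ℝ)} (K : KetFamily μ ι)
    (T : Submodule ℂ (Fock ι × Fock ι)) (lam : (J → ℝ) → ℝ) : Prop :=
  ∀ z ∈ T, ∀ g g' : {g // IsAmplitude μ g}, (∀ p, g'.1 p = lam p * g.1 p) →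
    inner ℂ z.2 (K.packet g) = inner ℂ z.1 (K.packet g')

/-- `M p p' = ⟨p| A |p'⟩`: the function `M` is the kernel of the matrix elements of the operator
`A` (given as a relation) between the generalized vectors `|p⟩`. -/
def KetFamily.IsMatrixElement {μ : Measure (J → ℝ)} (K : KetFamily μ ι)
    (A : Fock ι → Fock ι → Prop) (M : (J → ℝ) → (J → ℝ) → ℂ) : Prop :=
  AEStronglyMeasurable (Function.uncurry M) (μ.prod μ) ∧
  ∀ g g' : {g // IsAmplitude μ g}, ∃ y, A (K.packet g') y ∧
    Integrable (fun q : (J → ℝ) × (J → ℝ) =>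
      starRingEnd ℂ (g.1 q.1) * M q.1 q.2 * g'.1 q.2) (μ.prod μ) ∧
    inner ℂ (K.packet g) y =
      ∫ q, starRingEnd ℂ (g.1 q.1) * M q.1 q.2 * g'.1 q.2 ∂(μ.prod μ)

/-- `ψ p = √ε ∫ ⟨p| â(t) |p'⟩ dμ(p')` for (almost) all `p`, where `â(t) = U⁻¹ â U`. The matrix
elements are generalized vectors in `H`, and the integral is understood weakly, i.e. for the
components along each `f ∈ H`. -/
def KetFamily.IsIntegratedMatrixElement {H : Type*} [NormedAddCommGroup H]
    [InnerProductSpace ℂ H] (b : HilbertBasis ι ℂ H) {μ : Measure (J → ℝ)} (K : KetFamily μ ι)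
    (ε : ℝ) (U : Fock ι ≃ₗᵢ[ℂ] Fock ι) (ψ : (J → ℝ) → H) : Prop :=
  ∀ f : H, ∃ M, K.IsMatrixElement (IsHeisenbergAnnihilation b U f) M ∧
    ∀ᵐ p ∂μ, Integrable (M p) μ ∧ inner ℂ f (ψ p) = Real.sqrt ε * ∫ p', M p p' ∂μ

/-- The function `k ↦ exp (-(i/ε) ∫_{t₀}^t (h(s, p + ε k) - h(s, p)) ds)`. -/
def solitonPhase (ε : ℝ) (h : ℝ → (J → ℝ) → ℝ) (t₀ t : ℝ) (p k : J → ℝ) : ℂ :=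
  Complex.exp (-(Complex.I / ε) * ((∫ s in t₀..t, (h s (p + ε • k) - h s p) : ℝ) : ℂ))

end Generalized

end

set_option linter.unusedSectionVars false

/-! On wave packets, both the dynamics and the functions of `P` act through phases in the label; the
formula says that these phases match. Fix `f`, and let `M p p'` be the kernel of `a(f)`.

Dynamics: pair a solution `U s y` with the packet whose amplitude has been multiplied by
exp(-(i/ε)∫h). The generalized eigenvector relation makes the derivative of this pairing vanish
(`inner_packet_evolve_eq`). Since `y` runs through a dense set, `U t` maps each packet to the packet
with the multiplied amplitude (`propagator_packet`). Hence the kernel of `a(f)(t)` exists and equals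
exp(-(i/ε)∫(h(s,p') - h(s,p))ds) M(p,p') (`IsMatrixElement.heisenberg`).

Translations: the same conservation law, applied to the curves (exp(-irP_j)φ)^{⊗n}, shows that the
second quantization Γ(V) of V = exp(ia·P) multiplies |p⟩ by exp(ia·p/ε) (`ActsAsPhase.coord`,
`actsAsPhase_dot`). Since Γ(V)⁻¹ a(Vf) Γ(V) = a(f), the kernel of a(Vf) is exp(-ia·(p'-p)/ε) M(p,p')
almost everywhere (`IsMatrixElement.ae_eq_phaseKernel`). Integration over p' gives ⟨f,
exp(-ia·P)φ_p⟩ = √ε ∫ exp(-ia·k) M(p,p') dp' with k = (p'-p)/ε.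

Comparison: for fixed p this says that the complex measure ⟨f, E(·)φ_p⟩ and the image of √ε
M(p,p')dp' under p' ↦ k have the same characteristic function. So they coincide, and exp(-ia·k) may
be replaced by any bounded measurable m(k) (`IsIntegratedMatrixElement.exists_kernel`). Taking for m
the soliton phase at p, and using p + εk = p', the right side becomes the integral of the kernel at
time t. Conversely, kernels are unique up to null sets, so ψ is determined almost everywhere through
its components along a countable basis. -/

noncomputable section

/-! ### Bounded measurable functions and polarization -/

/-- Bounded measurable complex functions. -/
structure IsBoundedMeasurable {X : Type*} [MeasurableSpace X] (m : X → ℂ) : Prop where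
  measurable : Measurable m
  bounded : ∃ C, ∀ k, ‖m k‖ ≤ C

namespace IsBoundedMeasurable

variable {X : Type*} [MeasurableSpace X] {m n : X → ℂ}

theorem const (c : ℂ) : IsBoundedMeasurable fun _ : X => c :=
  ⟨measurable_const, ‖c‖, fun _ => le_rfl⟩

theorem add (hm : IsBoundedMeasurable m) (hn : IsBoundedMeasurable n) :
    IsBoundedMeasurable fun k => m k + n k := by
  obtain ⟨C, hC⟩ := hm.bounded
  obtain ⟨D, hD⟩ := hn.bounded
  exact ⟨hm.measurable.add hn.measurable, C + D, fun k =>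
    (norm_add_le _ _).trans (add_le_add (hC k) (hD k))⟩

theorem mul (hm : IsBoundedMeasurable m) (hn : IsBoundedMeasurable n) :
    IsBoundedMeasurable fun k => m k * n k := by
  obtain ⟨C, hC⟩ := hm.bounded
  obtain ⟨D, hD⟩ := hn.bounded
  refine ⟨hm.measurable.mul hn.measurable, C * D, fun k => ?_⟩
  rw [norm_mul]
  exact mul_le_mul (hC k) (hD k) (norm_nonneg _) ((norm_nonneg _).trans (hC k))

theorem const_mul (c : ℂ) (hm : IsBoundedMeasurable m) :
    IsBoundedMeasurable fun k => c * m k := (const c).mul hm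

theorem sub (hm : IsBoundedMeasurable m) (hn : IsBoundedMeasurable n) :
    IsBoundedMeasurable fun k => m k - n k := by
  simpa [sub_eq_add_neg] using hm.add (hn.const_mul (-1))

theorem conj (hm : IsBoundedMeasurable m) :
    IsBoundedMeasurable fun k => starRingEnd ℂ (m k) := by
  obtain ⟨C, hC⟩ := hm.bounded
  exact ⟨Complex.continuous_conj.measurable.comp hm.measurable, C, fun k => by simpa using hC k⟩

theorem indicator (hm : IsBoundedMeasurable m) {A : Set X} (hA : MeasurableSet A) :
    IsBoundedMeasurable (A.indicator m) := by
  obtain ⟨C, hC⟩ := hm.bounded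
  exact ⟨hm.measurable.indicator hA, C, fun k => (norm_indicator_le_norm_self _ _).trans (hC k)⟩

theorem simpleFunc (s : SimpleFunc X ℂ) : IsBoundedMeasurable s := by
  obtain ⟨C, hC⟩ := s.exists_forall_norm_le
  exact ⟨s.measurable, C, hC⟩

theorem integrable (hm : IsBoundedMeasurable m) (ν : Measure X) [IsFiniteMeasure ν] :
    Integrable m ν := by
  obtain ⟨C, hC⟩ := hm.bounded
  exact Integrable.of_bound hm.measurable.aestronglyMeasurable C (Eventually.of_forall hC)

/-- The function `k ↦ exp (i s · k)` is bounded and measurable. -/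
theorem cexp_ofReal_mul_I {u : X → ℝ} (hu : Measurable u) :
    IsBoundedMeasurable fun k => Complex.exp (u k * Complex.I) :=
  ⟨by fun_prop, 1, fun k => by rw [Complex.norm_exp_ofReal_mul_I]⟩

/-- A bounded measurable function is a uniformly bounded pointwise limit of simple functions. -/
theorem exists_approx (hm : IsBoundedMeasurable m) : ∃ (s : ℕ → SimpleFunc X ℂ) (D : ℝ),
    (∀ n k, ‖s n k‖ ≤ D) ∧ ∀ k, Tendsto (fun n => s n k) atTop (𝓝 (m k)) := by
  obtain ⟨C, hC⟩ := hm.bounded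
  have hC' : ∀ k, ‖m k‖ ≤ max C 0 := fun k => (hC k).trans (le_max_left _ _)
  exact ⟨hm.measurable.stronglyMeasurable.approxBounded (max C 0), max C 0, fun n k =>
    hm.measurable.stronglyMeasurable.norm_approxBounded_le (le_max_right _ _) n k,
    fun k => hm.measurable.stronglyMeasurable.tendsto_approxBounded_of_norm_le (hC' k)⟩

end IsBoundedMeasurable

/-- Over ℂ the quadratic form determines the operator. Identities of the functional calculus thus
reduce to identities of integrals against the scalar measures `E.measure x`. -/
theorem ContinuousLinearMap.eq_of_inner_self {H : Type*} [NormedAddCommGroup H]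
    [InnerProductSpace ℂ H] {S T : H →L[ℂ] H} (h : ∀ x, inner ℂ x (S x) = inner ℂ x (T x)) :
    S = T := by
  refine ContinuousLinearMap.coe_injective ((ext_inner_map _ _).1 fun x => ?_)
  have := congrArg (starRingEnd ℂ) (h x)
  simpa only [inner_conj_symm, ContinuousLinearMap.coe_coe] using this

/-- The polarization identity for the form `⟨y, T x⟩`. -/
theorem inner_apply_polarization {V H : Type*} [AddCommGroup V] [Module ℂ V]
    [NormedAddCommGroup H] [InnerProductSpace ℂ H] (S T : V →ₗ[ℂ] H) (x y : V) :
    inner ℂ (S y) (T x) = 4⁻¹ * (inner ℂ (S (x + y)) (T (x + y)) - inner ℂ (S (x - y)) (T (x - y))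
      + Complex.I * inner ℂ (S (x + Complex.I • y)) (T (x + Complex.I • y))
      - Complex.I * inner ℂ (S (x - Complex.I • y)) (T (x - Complex.I • y))) := by
  simp only [map_add, map_sub, map_smul, inner_add_left, inner_add_right, inner_sub_left,
    inner_sub_right, inner_smul_left, inner_smul_right, Complex.conj_I]
  ring_nf
  simp only [Complex.I_sq]
  ring

/-! ### The functional calculus of a projection-valued measure -/

namespace ProjectionValuedMeasure

variable {X H : Type*} [MeasurableSpace X] [NormedAddCommGroup H]
  [InnerProductSpace ℂ H] [CompleteSpace H] (E : ProjectionValuedMeasure X H) {m n : X → ℂ}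

theorem inner_integral_self (hm : IsBoundedMeasurable m) (x : H) :
    inner ℂ x (E.integral m x) = ∫ k, m k ∂(E.measure x) := by
  obtain ⟨C, hC⟩ := hm.bounded
  exact E.inner_integral hm.measurable hC x

theorem integral_eq_of_inner (hm : IsBoundedMeasurable m) {S : H →L[ℂ] H}
    (h : ∀ x, inner ℂ x (S x) = ∫ k, m k ∂(E.measure x)) : E.integral m = S :=
  ContinuousLinearMap.eq_of_inner_self fun x => by rw [E.inner_integral_self hm, h]

theorem integral_indicator_const {A : Set X} (hA : MeasurableSet A) (c : ℂ) :
    E.integral (A.indicator fun _ => c) = c • E.proj A := by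
  refine E.integral_eq_of_inner ((IsBoundedMeasurable.const c).indicator hA) fun x => ?_
  rw [integral_indicator hA, smul_apply, inner_smul_right, E.inner_proj hA]
  simp only [integral_const, Measure.real, Measure.restrict_apply_univ]
  rw [E.measure_apply x hA, ENNReal.toReal_ofReal (by positivity), Complex.real_smul, mul_comm]

theorem integral_add (hm : IsBoundedMeasurable m) (hn : IsBoundedMeasurable n) :
    E.integral (fun k => m k + n k) = E.integral m + E.integral n := by
  refine E.integral_eq_of_inner (hm.add hn) fun x => ?_
  rw [MeasureTheory.integral_add (hm.integrable _) (hn.integrable _), add_apply, inner_add_right,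
    E.inner_integral_self hm, E.inner_integral_self hn]

theorem integral_const_mul (c : ℂ) (hm : IsBoundedMeasurable m) :
    E.integral (fun k => c * m k) = c • E.integral m := by
  refine E.integral_eq_of_inner (hm.const_mul c) fun x => ?_
  rw [MeasureTheory.integral_const_mul, smul_apply, inner_smul_right, E.inner_integral_self hm]

theorem integral_sub (hm : IsBoundedMeasurable m) (hn : IsBoundedMeasurable n) :
    E.integral (fun k => m k - n k) = E.integral m - E.integral n := by
  have := E.integral_add hm (hn.const_mul (-1))
  rw [E.integral_const_mul _ hn] at this
  simpa [sub_eq_add_neg] using this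

theorem integral_one : E.integral (fun _ => 1) = 1 := by
  have := E.integral_indicator_const MeasurableSet.univ 1
  simpa [E.proj_univ] using this

theorem integral_conj (hm : IsBoundedMeasurable m) :
    E.integral (fun k => starRingEnd ℂ (m k)) = (E.integral m).adjoint := by
  refine E.integral_eq_of_inner hm.conj fun x => ?_
  rw [ContinuousLinearMap.adjoint_inner_right, ← inner_conj_symm, E.inner_integral_self hm,
    ← _root_.integral_conj]

theorem inner_integral_eq (hm : IsBoundedMeasurable m) (x y : H) :
    inner ℂ y (E.integral m x) = 4⁻¹ * (∫ k, m k ∂(E.measure (x + y))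
      - ∫ k, m k ∂(E.measure (x - y))
      + Complex.I * ∫ k, m k ∂(E.measure (x + Complex.I • y))
      - Complex.I * ∫ k, m k ∂(E.measure (x - Complex.I • y))) := by
  have h := inner_apply_polarization LinearMap.id (E.integral m : H →ₗ[ℂ] H) x y
  simpa only [LinearMap.id_apply, ContinuousLinearMap.coe_coe, E.inner_integral_self hm] using h

theorem tendsto_inner_integral {s : ℕ → X → ℂ} {D : ℝ} (hs : ∀ n, Measurable (s n))
    (hD : ∀ n k, ‖s n k‖ ≤ D) (hm : IsBoundedMeasurable m)
    (hsm : ∀ k, Tendsto (fun n => s n k) atTop (𝓝 (m k))) (x y : H) :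
    Tendsto (fun n => inner ℂ y (E.integral (s n) x)) atTop (𝓝 (inner ℂ y (E.integral m x))) := by
  have key : ∀ z, Tendsto (fun n => ∫ k, s n k ∂(E.measure z)) atTop
      (𝓝 (∫ k, m k ∂(E.measure z))) := fun z =>
    tendsto_integral_of_dominated_convergence (fun _ => D)
      (fun n => (hs n).aestronglyMeasurable) (integrable_const D)
      (fun n => Eventually.of_forall (hD n)) (Eventually.of_forall hsm)
  simp only [E.inner_integral_eq hm, fun n => E.inner_integral_eq ⟨hs n, D, hD n⟩]
  exact ((((key _).sub (key _)).add ((key _).const_mul _)).sub ((key _).const_mul _)).const_mul _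

theorem integral_simpleFunc_mul (s : SimpleFunc X ℂ) (hn : IsBoundedMeasurable n)
    (h : ∀ A, MeasurableSet A →
      E.integral (fun k => A.indicator 1 k * n k) = E.proj A * E.integral n) :
    E.integral (fun k => s k * n k) = E.integral s * E.integral n := by
  induction s using SimpleFunc.induction with
  | @const c A hA =>
    have e : ⇑(SimpleFunc.piecewise A hA (SimpleFunc.const X c) (SimpleFunc.const X 0)) =
        A.indicator fun _ => c := by
      ext k; by_cases hk : k ∈ A <;> simp [hk]
    rw [e, E.integral_indicator_const hA, smul_mul_assoc, ← h A hA, ← E.integral_const_mul]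
    · congr 1; ext k; by_cases hk : k ∈ A <;> simp [hk]
    · exact ((IsBoundedMeasurable.const 1).indicator hA).mul hn
  | @add f g _ hf hg =>
    simp only [SimpleFunc.coe_add, Pi.add_apply, add_mul]
    have bf := IsBoundedMeasurable.simpleFunc f
    have bg := IsBoundedMeasurable.simpleFunc g
    rw [E.integral_add (bf.mul hn) (bg.mul hn), hf, hg, ← add_mul, ← E.integral_add bf bg]
    rfl

/-- Multiplicativity with an indicator as first factor passes to simple functions by linearity, and
then to bounded measurable ones by dominated convergence of matrix elements. -/
theorem integral_mul_of_forall_proj (hm : IsBoundedMeasurable m) (hn : IsBoundedMeasurable n)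
    (h : ∀ A, MeasurableSet A →
      E.integral (fun k => A.indicator 1 k * n k) = E.proj A * E.integral n) :
    E.integral (fun k => m k * n k) = E.integral m * E.integral n := by
  obtain ⟨s, D, hD, hs⟩ := hm.exists_approx
  obtain ⟨C, hC⟩ := hn.bounded
  ext x
  refine ext_inner_left ℂ fun y => ?_
  have h1 := E.tendsto_inner_integral (fun j => (s j).measurable) hD hm hs (E.integral n x) y
  have h2 := E.tendsto_inner_integral (s := fun j k => s j k * n k) (D := D * C)
    (fun j => (s j).measurable.mul hn.measurable) (fun j k => by
      rw [norm_mul]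
      exact mul_le_mul (hD j k) (hC k) (norm_nonneg _) ((norm_nonneg _).trans (hD j k)))
    (hm.mul hn) (fun k => (hs k).mul_const (n k)) x y
  refine tendsto_nhds_unique h2 (h1.congr fun j => ?_)
  rw [E.integral_simpleFunc_mul (s j) hn h]
  rfl

/-- A bootstrap. When the second factor is an indicator, the hypothesis of
`integral_mul_of_forall_proj` is `proj_inter`. Taking adjoints moves the indicator to the first
place, which is the hypothesis for a general second factor. -/
theorem integral_mul (hm : IsBoundedMeasurable m) (hn : IsBoundedMeasurable n) :
    E.integral (fun k => m k * n k) = E.integral m * E.integral n := by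
  refine E.integral_mul_of_forall_proj hm hn fun A hA => ?_
  have hA1 := (IsBoundedMeasurable.const (X := X) 1).indicator hA
  have e1 := E.integral_indicator_const hA 1
  rw [one_smul] at e1
  have e2 : (fun k => A.indicator 1 k * n k) = fun k => n k * A.indicator (fun _ => (1 : ℂ)) k := by
    ext k; rw [mul_comm]; rfl
  have e3 : ∀ B, MeasurableSet B →
      E.integral (fun k => B.indicator 1 k * A.indicator (fun _ => (1 : ℂ)) k) =
        E.proj B * E.integral (A.indicator fun _ => (1 : ℂ)) := by
    intro B hB
    rw [e1, ← E.proj_inter B A hB hA, ← one_smul ℂ (E.proj (B ∩ A)),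
      ← E.integral_indicator_const (hB.inter hA)]
    congr 1; ext k
    by_cases hk : k ∈ A <;> by_cases hk' : k ∈ B <;> simp [hk, hk']
  have e4 := E.integral_mul_of_forall_proj hn hA1 e3
  -- the adjoint of the product with the conjugate function
  have e5 := E.integral_mul_of_forall_proj hn.conj hA1 e3
  have hs : (E.proj A).adjoint = E.proj A := (E.isStarProjection A hA).isSelfAdjoint.star_eq
  have e6 := congrArg ContinuousLinearMap.adjoint e5
  rw [← E.integral_conj (hn.conj.mul hA1), e1, E.integral_conj hn] at e6
  have e7 : ((E.integral n).adjoint * E.proj A).adjoint = E.proj A * E.integral n := by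
    change star (star (E.integral n) * E.proj A) = _
    rw [star_mul, star_star]
    exact congrArg (· * E.integral n) hs
  rw [e7] at e6
  rw [← e6]
  congr 1; ext k
  by_cases hk : k ∈ A <;> simp [hk]

/-- The adjoint of m(P) is given by the conjugate function, so multiplicativity turns ⟨m(P)x, m(P)x⟩
into the form of |m|². The norm estimates for functions of `P` rest on this. -/
theorem norm_integral_apply_sq (hm : IsBoundedMeasurable m) (x : H) :
    ‖E.integral m x‖ ^ 2 = ∫ k, ‖m k‖ ^ 2 ∂(E.measure x) := by
  have h1 : inner ℂ (E.integral m x) (E.integral m x) = ((∫ k, ‖m k‖ ^ 2 ∂(E.measure x) : ℝ) : ℂ) := by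
    rw [← ContinuousLinearMap.adjoint_inner_right, ← E.integral_conj hm]
    change inner ℂ x ((E.integral _ * E.integral m) x) = _
    rw [← E.integral_mul hm.conj hm,
      E.inner_integral_self (hm.conj.mul hm)]
    refine Eq.trans (integral_congr_ae (Eventually.of_forall fun k => ?_)) integral_ofReal
    change starRingEnd ℂ (m k) * m k = ((‖m k‖ ^ 2 : ℝ) : ℂ)
    rw [← Complex.normSq_eq_conj_mul_self, Complex.normSq_eq_norm_sq]
  rw [inner_self_eq_norm_sq_to_K] at h1
  exact Complex.ofReal_injective (by rw [← h1]; push_cast; rfl)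

theorem norm_integral_apply_le {C : ℝ} (hm : IsBoundedMeasurable m) {x : H}
    (h : ∀ᵐ k ∂(E.measure x), ‖m k‖ ≤ C) (hC : 0 ≤ C) : ‖E.integral m x‖ ≤ C * ‖x‖ := by
  refine le_of_sq_le_sq ?_ (by positivity)
  rw [E.norm_integral_apply_sq hm, mul_pow]
  have h2 : ∫ k, ‖m k‖ ^ 2 ∂(E.measure x) ≤ ∫ _, C ^ 2 ∂(E.measure x) := by
    refine integral_mono_of_nonneg (Eventually.of_forall fun k => by positivity)
      (integrable_const _) (h.mono fun k hk => ?_)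
    exact pow_le_pow_left₀ (norm_nonneg _) hk 2
  refine h2.trans (le_of_eq ?_)
  rw [integral_const, Measure.real, E.measure_univ, ENNReal.toReal_ofReal (by positivity),
    smul_eq_mul, mul_comm]

theorem integral_apply_congr (hm : IsBoundedMeasurable m) (hn : IsBoundedMeasurable n) {x : H}
    (h : ∀ᵐ k ∂(E.measure x), m k = n k) : E.integral m x = E.integral n x := by
  have h1 := E.norm_integral_apply_le (hm.sub hn) (C := 0) (h.mono fun k hk => by simp [hk]) le_rfl
  rw [E.integral_sub hm hn, zero_mul, sub_apply] at h1
  exact sub_eq_zero.1 (norm_le_zero_iff.1 h1)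

/-- The unitary operator `exp (i u(P))`. -/
def phase {u : X → ℝ} (hu : Measurable u) : H ≃ₗᵢ[ℂ] H :=
  have hp : IsBoundedMeasurable fun k => Complex.exp (u k * Complex.I) :=
    IsBoundedMeasurable.cexp_ofReal_mul_I hu
  have hn : IsBoundedMeasurable fun k => Complex.exp ((-u k : ℝ) * Complex.I) :=
    IsBoundedMeasurable.cexp_ofReal_mul_I hu.neg
  { toLinearEquiv := LinearEquiv.ofLinearMap
      (E.integral fun k => Complex.exp (u k * Complex.I) : H →ₗ[ℂ] H)
      (E.integral fun k => Complex.exp ((-u k : ℝ) * Complex.I) : H →ₗ[ℂ] H)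
      (by
        have := E.integral_mul hp hn
        simp only [← Complex.exp_add, ← add_mul, ← Complex.ofReal_add, add_neg_cancel,
          Complex.ofReal_zero, zero_mul,
          Complex.exp_zero, E.integral_one] at this
        exact (congrArg ContinuousLinearMap.toLinearMap this).symm)
      (by
        have := E.integral_mul hn hp
        simp only [← Complex.exp_add, ← add_mul, ← Complex.ofReal_add, neg_add_cancel,
          Complex.ofReal_zero, zero_mul,
          Complex.exp_zero, E.integral_one] at this
        exact (congrArg ContinuousLinearMap.toLinearMap this).symm)
    norm_map' := fun x => by
      change ‖E.integral _ x‖ = ‖x‖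
      refine (sq_eq_sq₀ (norm_nonneg _) (norm_nonneg _)).1 ?_
      rw [E.norm_integral_apply_sq hp]
      simp only [Complex.norm_exp_ofReal_mul_I, one_pow, integral_const, smul_eq_mul, mul_one]
      rw [Measure.real, E.measure_univ, ENNReal.toReal_ofReal (by positivity)] }

theorem phase_apply {u : X → ℝ} (hu : Measurable u) (x : H) :
    E.phase hu x = E.integral (fun k => Complex.exp (u k * Complex.I)) x := rfl

theorem phase_phase {u v : X → ℝ} (hu : Measurable u) (hv : Measurable v) (x : H) :
    E.phase hu (E.phase hv x) = E.phase (hu.add hv) x := by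
  simp only [phase_apply]
  have := E.integral_mul (IsBoundedMeasurable.cexp_ofReal_mul_I hu)
    (IsBoundedMeasurable.cexp_ofReal_mul_I hv)
  simp only [← Complex.exp_add, ← add_mul, ← Complex.ofReal_add] at this
  exact (congrArg (fun T : H →L[ℂ] H => T x) this).symm

theorem measure_compl_eq_zero {A : Set X} (hA : MeasurableSet A) {x : H} (hx : E.proj A x = x) :
    ∀ᵐ k ∂(E.measure x), k ∈ A := by
  change E.measure x Aᶜ = 0
  rw [E.measure_apply x hA.compl, ← hx]
  change ENNReal.ofReal (‖(E.proj Aᶜ * E.proj A) x‖ ^ 2) = 0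
  rw [← E.proj_inter _ _ hA.compl hA, Set.compl_inter_self, E.proj_empty]
  simp

theorem tendsto_proj {A : ℕ → Set X} (hA : ∀ n, MeasurableSet (A n))
    (h : ∀ k, ∀ᶠ n in atTop, k ∈ A n) (x : H) :
    Tendsto (fun n => E.proj (A n) x) atTop (𝓝 x) := by
  rw [tendsto_iff_norm_sub_tendsto_zero]
  have e : ∀ n, ‖E.proj (A n) x - x‖ ^ 2 =
      ∫ k, ‖(A n).indicator (fun _ => (1 : ℂ)) k - 1‖ ^ 2 ∂(E.measure x) := by
    intro n
    have h1 := (IsBoundedMeasurable.const (X := X) 1).indicator (hA n)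
    rw [← E.norm_integral_apply_sq (h1.sub (IsBoundedMeasurable.const 1)),
      E.integral_sub h1 (IsBoundedMeasurable.const 1), E.integral_indicator_const (hA n),
      E.integral_one, one_smul]
    rfl
  have h2 : Tendsto (fun n => ‖E.proj (A n) x - x‖ ^ 2) atTop (𝓝 0) := by
    simp only [e]
    rw [← integral_zero X ℝ (μ := E.measure x)]
    refine tendsto_integral_of_dominated_convergence (fun _ => 1) (fun n => ?_)
      (integrable_const _) (fun n => Eventually.of_forall fun k => ?_)
      (Eventually.of_forall fun k => ?_)
    · exact ((((measurable_const.indicator (hA n)).sub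
        measurable_const).norm).pow_const 2).aestronglyMeasurable
    · by_cases hk : k ∈ A n <;> simp [hk]
    · refine tendsto_const_nhds.congr' ((h k).mono fun n hn => ?_)
      simp [hn]
  have h3 := h2.sqrt
  simpa using h3

end ProjectionValuedMeasure

/-! ### The unitary groups of the operators `P j` -/

namespace IsJointSpectralMeasure

variable {J H : Type*} [NormedAddCommGroup H] [InnerProductSpace ℂ H]
    [CompleteSpace H] {P : J → H →ₗ.[ℂ] H} {E : ProjectionValuedMeasure (J → ℝ) H}

/-- The set where the `j`-th coordinate is bounded by `n`. -/
def slab (j : J) (n : ℕ) : Set (J → ℝ) := {k | |k j| ≤ n}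

theorem measurableSet_slab (j : J) (n : ℕ) : MeasurableSet (slab j n) :=
  measurableSet_le (measurable_pi_apply j).abs measurable_const

theorem slab_mono (j : J) {m n : ℕ} (h : m ≤ n) : slab j m ⊆ slab j n := fun k hk => by
  have h1 : |k j| ≤ m := hk
  exact h1.trans (by exact_mod_cast h)

theorem dense_slab (E : ProjectionValuedMeasure (J → ℝ) H) (j : J) :
    Dense {x : H | ∃ n, E.proj (slab j n) x = x} := by
  intro x
  refine mem_closure_of_tendsto (E.tendsto_proj (measurableSet_slab j) (fun k => ?_) x)
    (Eventually.of_forall fun n => ⟨n, ?_⟩)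
  · obtain ⟨N, hN⟩ := exists_nat_ge |k j|
    exact eventually_atTop.2 ⟨N, fun n hn => hN.trans (by exact_mod_cast hn)⟩
  · change (E.proj _ * E.proj _) x = _
    rw [← E.proj_inter _ _ (measurableSet_slab j n) (measurableSet_slab j n), Set.inter_self]

theorem proj_slab_mono (E : ProjectionValuedMeasure (J → ℝ) H) {j : J} {m n : ℕ} (h : m ≤ n)
    {x : H} (hx : E.proj (slab j m) x = x) : E.proj (slab j n) x = x := by
  rw [← hx]
  change (E.proj _ * E.proj _) x = _
  rw [← E.proj_inter _ _ (measurableSet_slab j n) (measurableSet_slab j m),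
    Set.inter_eq_right.2 (slab_mono j h)]

/-- The `j`-th coordinate, cut off at `n`. -/
def cutoff (j : J) (n : ℕ) : (J → ℝ) → ℂ := (slab j n).indicator fun k => (k j : ℂ)

theorem isBoundedMeasurable_cutoff (j : J) (n : ℕ) : IsBoundedMeasurable (cutoff j n) := by
  refine ⟨Measurable.indicator (by fun_prop) (measurableSet_slab j n), n, fun k => ?_⟩
  by_cases hk : k ∈ slab j n
  · rw [cutoff, Set.indicator_of_mem hk, Complex.norm_real]
    exact hk
  · simp [cutoff, hk]

theorem mem_domain (hE : IsJointSpectralMeasure P E) {j : J} {n : ℕ} {x : H}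
    (hx : E.proj (slab j n) x = x) : x ∈ (P j).domain := by
  rw [hE.mem_domain_iff]
  refine Integrable.of_bound
    ((measurable_pi_apply j).pow_const 2).aestronglyMeasurable ((n : ℝ) ^ 2)
    ((E.measure_compl_eq_zero (measurableSet_slab j n) hx).mono fun k hk => ?_)
  rw [norm_pow, Real.norm_eq_abs]
  exact pow_le_pow_left₀ (abs_nonneg _) hk 2

/-- The hypothesis on `P j` gives only its domain and quadratic form. The range of a slab projection
is a subspace of the domain, so polarization there recovers ⟨y, P_j x⟩, and the union of these
ranges is dense. -/
theorem apply_eq_integral_cutoff (hE : IsJointSpectralMeasure P E) {j : J} {n : ℕ} {x : H}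
    (hx : E.proj (slab j n) x = x) :
    P j ⟨x, hE.mem_domain hx⟩ = E.integral (cutoff j n) x := by
  have key : ∀ m (x y : H) (hx : E.proj (slab j m) x = x), E.proj (slab j m) y = y →
      inner ℂ y (P j ⟨x, hE.mem_domain hx⟩) = inner ℂ y (E.integral (cutoff j m) x) := by
    intro m x y hx hy
    let D : Submodule ℂ H := LinearMap.eqLocus (E.proj (slab j m) : H →ₗ[ℂ] H) LinearMap.id
    have hD : D ≤ (P j).domain := fun x hx => hE.mem_domain hx
    have hdiag : ∀ z : D, inner ℂ (z : H) (P j ⟨z, hD z.2⟩) =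
        inner ℂ (z : H) (E.integral (cutoff j m) z) := by
      intro z
      rw [hE.inner_apply j ⟨z, hD z.2⟩, E.inner_integral_self (isBoundedMeasurable_cutoff j m)]
      refine Eq.trans integral_ofReal.symm (integral_congr_ae
        ((E.measure_compl_eq_zero (measurableSet_slab j m) z.2).mono fun k hk => ?_))
      rw [cutoff, Set.indicator_of_mem hk]
      rfl
    have h1 := inner_apply_polarization D.subtype ((P j).toFun ∘ₗ Submodule.inclusion hD)
      ⟨x, hx⟩ ⟨y, hy⟩
    have h2 := inner_apply_polarization D.subtype
      ((E.integral (cutoff j m) : H →ₗ[ℂ] H) ∘ₗ D.subtype) ⟨x, hx⟩ ⟨y, hy⟩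
    have hd : ∀ z : D, inner ℂ (D.subtype z) (((P j).toFun ∘ₗ Submodule.inclusion hD) z) =
      inner ℂ (D.subtype z) (((E.integral (cutoff j m) : H →ₗ[ℂ] H) ∘ₗ D.subtype) z) := hdiag
    simp only [hd] at h1
    rw [← h2] at h1
    exact h1
  refine (dense_slab E j).eq_of_inner_right ℂ fun y ⟨m, hy⟩ => ?_
  -- Polarization needs both vectors in one slab. The two cutoffs agree on the smaller slab, which
  -- carries the spectral measure of `x`.
  have h1 := key (max m n) x y (proj_slab_mono E (le_max_right _ _) hx)
    (proj_slab_mono E (le_max_left _ _) hy)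
  rw [h1]
  congr 1
  refine E.integral_apply_congr (isBoundedMeasurable_cutoff _ _) (isBoundedMeasurable_cutoff _ _)
    ((E.measure_compl_eq_zero (measurableSet_slab j n) hx).mono fun k hk => ?_)
  rw [cutoff, cutoff, Set.indicator_of_mem hk, Set.indicator_of_mem (slab_mono j (le_max_right _ _) hk)]

theorem measurable_smul_coord (j : J) (s : ℝ) : Measurable fun k : J → ℝ => s * k j := by fun_prop

/-- Functions of `P` commute with the spectral projections, so the orbit of `x` stays where `P j` is
bounded. -/
theorem proj_phase (E : ProjectionValuedMeasure (J → ℝ) H) {j : J} {n : ℕ} {x : H}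
    (hx : E.proj (slab j n) x = x) {u : (J → ℝ) → ℝ} (hu : Measurable u) :
    E.proj (slab j n) (E.phase hu x) = E.phase hu x := by
  have h1 := (IsBoundedMeasurable.const (X := J → ℝ) 1).indicator (measurableSet_slab j n)
  have h2 := IsBoundedMeasurable.cexp_ofReal_mul_I hu
  have h3 := E.integral_mul h1 h2
  have h4 := E.integral_mul h2 h1
  rw [show (fun k => Complex.exp (u k * Complex.I) * (slab j n).indicator (fun _ => (1 : ℂ)) k) =
    fun k => (slab j n).indicator (fun _ => (1 : ℂ)) k * Complex.exp (u k * Complex.I) from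
    funext fun k => mul_comm _ _, h3, E.integral_indicator_const (measurableSet_slab j n), one_smul] at h4
  have h5 := congrArg (fun T : H →L[ℂ] H => T x) h4
  simp only [ContinuousLinearMap.mul_def, ContinuousLinearMap.comp_apply, hx] at h5
  exact h5

/-- On the slab |k_j| ≤ n, the bound |exp(z) - 1 - z| ≤ |z|² for |z| ≤ 1 is uniform in k, so the
remainder has norm at most n²|r-s|²‖x‖. The condition |r-s|n < 1 ensures |z| ≤ 1. -/
theorem hasDerivAt_phase (hE : IsJointSpectralMeasure P E) {j : J} {n : ℕ} {x : H}
    (hx : E.proj (slab j n) x = x) (s : ℝ) :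
    HasDerivAt (fun s => E.phase (measurable_smul_coord j s) x)
      (Complex.I • P j ⟨E.phase (measurable_smul_coord j s) x,
        hE.mem_domain (proj_phase E hx (measurable_smul_coord j s))⟩) s := by
  rw [hE.apply_eq_integral_cutoff (proj_phase E hx (measurable_smul_coord j s))]
  have hc := isBoundedMeasurable_cutoff j n
  have hp : ∀ r : ℝ, IsBoundedMeasurable fun k : J → ℝ =>
      Complex.exp (((r * k j : ℝ) : ℂ) * Complex.I) := fun r =>
    IsBoundedMeasurable.cexp_ofReal_mul_I (measurable_smul_coord j r)
  have hO : (fun r => E.phase (measurable_smul_coord j r) x - E.phase (measurable_smul_coord j s) x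
      - (r - s) • (Complex.I • E.integral (cutoff j n) (E.phase (measurable_smul_coord j s) x)))
      =O[𝓝 s] fun r => ‖r - s‖ ^ 2 := by
    refine Asymptotics.IsBigO.of_bound ((n : ℝ) ^ 2 * ‖x‖) ?_
    have hev : ∀ᶠ r in 𝓝 s, |r - s| * n < 1 := by
      have : Tendsto (fun r : ℝ => |r - s| * n) (𝓝 s) (𝓝 (|s - s| * n)) :=
        Continuous.tendsto (by fun_prop) s
      rw [sub_self, abs_zero, zero_mul] at this
      exact this.eventually_lt_const one_pos
    refine hev.mono fun r hr => ?_
    have e : E.phase (measurable_smul_coord j r) x - E.phase (measurable_smul_coord j s) x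
      - (r - s) • (Complex.I • E.integral (cutoff j n) (E.phase (measurable_smul_coord j s) x)) =
      E.integral (fun k => (Complex.exp (((r * k j : ℝ) : ℂ) * Complex.I) -
        Complex.exp (((s * k j : ℝ) : ℂ) * Complex.I)) - ((r - s : ℝ) * Complex.I) *
          (cutoff j n k * Complex.exp (((s * k j : ℝ) : ℂ) * Complex.I))) x := by
      rw [E.integral_sub ((hp r).sub (hp s)) ((hc.mul (hp s)).const_mul _),
        E.integral_sub (hp r) (hp s), E.integral_const_mul _ (hc.mul (hp s)),
        E.integral_mul hc (hp s)]
      simp only [sub_apply, smul_apply, mul_smul]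
      rfl
    rw [e]
    refine (E.norm_integral_apply_le (C := (n : ℝ) ^ 2 * ‖r - s‖ ^ 2)
      (((hp r).sub (hp s)).sub ((hc.mul (hp s)).const_mul _))
      ((E.measure_compl_eq_zero (measurableSet_slab j n) hx).mono fun k hk => ?_)
      (by positivity)).trans (le_of_eq ?_)
    · rw [cutoff, Set.indicator_of_mem hk]
      have hk' : |k j| ≤ n := hk
      have e2 : Complex.exp (((r * k j : ℝ) : ℂ) * Complex.I) =
          Complex.exp (((s * k j : ℝ) : ℂ) * Complex.I) *
            Complex.exp ((((r - s) * k j : ℝ) : ℂ) * Complex.I) := by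
        rw [← Complex.exp_add]; push_cast; ring_nf
      rw [e2]
      have e3 : ∀ a z w c d : ℂ, a * z - a - (c * d) * (w * a) = a * (z - 1 - w * c * d) := by
        intros; ring
      rw [e3, norm_mul, Complex.norm_exp_ofReal_mul_I, one_mul]
      have e4 : (k j : ℂ) * ((r - s : ℝ) : ℂ) * Complex.I =
          (((r - s) * k j : ℝ) : ℂ) * Complex.I := by push_cast; ring
      rw [e4]
      have hle : ‖(((r - s) * k j : ℝ) : ℂ) * Complex.I‖ ≤ n * ‖r - s‖ := by
        rw [norm_mul, Complex.norm_I, mul_one, Complex.norm_real, norm_mul, mul_comm]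
        exact mul_le_mul_of_nonneg_right hk' (norm_nonneg _)
      have hle1 : (n : ℝ) * ‖r - s‖ ≤ 1 := by
        rw [mul_comm]; exact hr.le
      refine (Complex.norm_exp_sub_one_sub_id_le (hle.trans hle1)).trans ?_
      rw [← mul_pow]
      exact pow_le_pow_left₀ (norm_nonneg _) hle 2
    · rw [norm_pow, norm_norm]; ring
  have hl : (fun r : ℝ => ‖r - s‖ ^ 2) =o[𝓝 s] fun r => r - s := by
    have := Asymptotics.isLittleO_pow_sub_sub s one_lt_two
    exact this
  rw [hasDerivAt_iff_isLittleO]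
  exact hO.trans_isLittleO hl

end IsJointSpectralMeasure

/-! ### Elementary tensors, contractions and second quantized unitaries -/

section Creation

variable {ι H : Type*} [NormedAddCommGroup H] [InnerProductSpace ℂ H] (b : HilbertBasis ι ℂ H)

/-- The coordinates of `f ⊗ y`. -/
def consCoord (f : H) (y : FullFock ι) : List ι → ℂ
  | [] => 0
  | i :: l => b.repr f i * y l

theorem cons_uncurry_injective : Function.Injective fun c : ι × List ι => c.1 :: c.2 := by
  rintro ⟨i, l⟩ ⟨i', l'⟩ h
  simpa using h

theorem mem_range_cons_of_ne_nil {l : List ι} (hl : l ≠ []) :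
    l ∈ Set.range fun c : ι × List ι => c.1 :: c.2 := by
  cases l with
  | nil => exact absurd rfl hl
  | cons i l => exact ⟨(i, l), rfl⟩

theorem memℓp_consCoord (f : H) (y : FullFock ι) : Memℓp (consCoord b f y) 2 := by
  have h2 : 0 < (2 : ℝ≥0∞).toReal := by norm_num
  have h := memℓp_two_of_mul (b.repr f).2 y.2 (fun c : ι × List ι => c) Function.injective_id
  rw [memℓp_gen_iff h2] at h ⊢
  rw [← cons_uncurry_injective.summable_iff]
  · exact h
  · intro l hl
    cases l with
    | nil => simp [consCoord]
    | cons i l => exact absurd ⟨(i, l), rfl⟩ hl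

/-- The tensor `f ⊗ y`. -/
def consTensor (f : H) (y : FullFock ι) : FullFock ι := ⟨consCoord b f y, memℓp_consCoord b f y⟩

theorem consTensor_nil (f : H) (y : FullFock ι) : consTensor b f y [] = 0 := rfl

theorem consTensor_cons (f : H) (y : FullFock ι) (i : ι) (l : List ι) :
    consTensor b f y (i :: l) = b.repr f i * y l := rfl

theorem tsum_mul_tsum_complex {α β : Type*} {u : α → ℂ} {v : β → ℂ} (hu : Summable u)
    (hv : Summable v) : (∑' a, u a) * ∑' c, v c = ∑' c : α × β, u c.1 * v c.2 :=
  tsum_mul_tsum_of_summable_norm hu.norm hv.norm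

theorem inner_consTensor (f g : H) (x y : FullFock ι) :
    inner ℂ (consTensor b f x) (consTensor b g y) = inner ℂ f g * inner ℂ x y := by
  have h1 : Function.support (fun l => inner ℂ (consTensor b f x l) (consTensor b g y l)) ⊆
      Set.range fun c : ι × List ι => c.1 :: c.2 := by
    intro l hl
    refine mem_range_cons_of_ne_nil fun h => hl ?_
    subst h
    simp [consTensor_nil]
  have h2 : inner ℂ f g * inner ℂ x y = ∑' c : ι × List ι,
      inner ℂ (b.repr f c.1) (b.repr g c.1) * inner ℂ (x c.2) (y c.2) := by
    rw [← b.repr.inner_map_map f g, lp.inner_eq_tsum (b.repr f), lp.inner_eq_tsum x]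
    exact tsum_mul_tsum_complex (u := fun i => inner ℂ (b.repr f i) (b.repr g i))
      (v := fun l => inner ℂ (x l) (y l)) (lp.summable_inner _ _) (lp.summable_inner _ _)
  rw [h2, lp.inner_eq_tsum (consTensor b f x), ← cons_uncurry_injective.tsum_eq h1]
  refine tsum_congr fun c => ?_
  simp only [consTensor_cons, RCLike.inner_apply, map_mul]
  ring

theorem norm_consTensor (f : H) (x : FullFock ι) : ‖consTensor b f x‖ = ‖f‖ * ‖x‖ := by
  have h := inner_consTensor b f f x x
  simp only [inner_self_eq_norm_sq_to_K] at h
  refine (sq_eq_sq₀ (norm_nonneg _) (by positivity)).1 ?_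
  rw [mul_pow]
  exact Complex.ofReal_injective (by push_cast; exact h)

/-- The creation map `f ↦ (y ↦ f ⊗ y)`. -/
def creation : H →L[ℂ] FullFock ι →L[ℂ] FullFock ι :=
  LinearMap.mkContinuous₂ (LinearMap.mk₂ ℂ (consTensor b)
    (fun f g y => by
      ext l
      cases l with
      | nil => simp [consTensor_nil]
      | cons i l => simp [consTensor_cons, add_mul])
    (fun c f y => by
      ext l
      cases l with
      | nil => simp [consTensor_nil]
      | cons i l => simp [consTensor_cons, mul_assoc])
    (fun f x y => by
      ext l
      cases l with
      | nil => simp [consTensor_nil]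
      | cons i l => simp [consTensor_cons, mul_add])
    (fun c f y => by
      ext l
      cases l with
      | nil => simp [consTensor_nil]
      | cons i l => simp [consTensor_cons]; ring)) 1
    (fun f y => by rw [one_mul]; exact (norm_consTensor b f y).le)

theorem creation_apply (f : H) (y : FullFock ι) : creation b f y = consTensor b f y := rfl

theorem tensor_cons (f : H) (fs : List H) : tensor b (f :: fs) = creation b f (tensor b fs) := by
  ext l
  cases l with
  | nil => rfl
  | cons i l => rfl

/-- The contraction of the first factor with `f`. -/
def contraction (f : H) : FullFock ι →L[ℂ] FullFock ι := (creation b f).adjoint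

theorem inner_tensor_cons (f : H) (fs : List H) (x : FullFock ι) :
    inner ℂ (tensor b (f :: fs)) x = inner ℂ (tensor b fs) (contraction b f x) := by
  rw [tensor_cons, contraction, ContinuousLinearMap.adjoint_inner_right]

theorem contraction_apply (f : H) (x : FullFock ι) (l : List ι) :
    contraction b f x l = ∑' i, inner ℂ f (b i) * x (i :: l) := by
  classical
  have h1 : contraction b f x l = inner ℂ (lp.single 2 l (1 : ℂ) : FullFock ι) (contraction b f x) := by
    rw [lp.inner_single_left]; simp
  rw [h1, contraction, ContinuousLinearMap.adjoint_inner_right, creation_apply,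
    lp.inner_eq_tsum]
  have h2 : Function.Injective fun i : ι => i :: l := fun i j h => by simpa using h
  rw [← h2.tsum_eq]
  · refine tsum_congr fun i => ?_
    rw [consTensor_cons, lp.single_apply_self, RCLike.inner_apply, mul_one, b.repr_apply_apply,
      inner_conj_symm, mul_comm]
  · intro l' hl'
    cases l' with
    | nil => simp [consTensor_nil] at hl'
    | cons i l' =>
      refine ⟨i, ?_⟩
      by_contra hne
      apply hl'
      have : l' ≠ l := fun h => hne (by rw [h])
      simp only [consTensor_cons]
      rw [lp.single_apply_ne (hij := this)]
      simp

theorem isAnnihilation_iff (f : H) (x y : Fock ι) :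
    IsAnnihilation b f x y ↔ ∀ l : List ι, (y : FullFock ι) l =
      (Real.sqrt (l.length + 1) : ℂ) * contraction b f (x : FullFock ι) l := by
  simp only [IsAnnihilation, contraction_apply]

theorem contraction_mem_fock (f : H) {x : FullFock ι} (hx : x ∈ Fock ι) :
    contraction b f x ∈ Fock ι := by
  intro l l' h
  rw [contraction_apply, contraction_apply]
  exact tsum_congr fun i => by rw [hx _ _ (h.cons i)]

/-- Exchange the first two entries of a list. -/
def swapHead : List ι → List ι
  | i :: j :: l => j :: i :: l
  | l => l

theorem swapHead_involutive : Function.Involutive (swapHead (ι := ι)) := by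
  intro l
  match l with
  | [] => rfl
  | [_] => rfl
  | _ :: _ :: _ => rfl

theorem perm_swapHead (l : List ι) : (swapHead l).Perm l := by
  match l with
  | [] => exact .refl _
  | [_] => exact .refl _
  | _ :: _ :: _ => exact .swap _ _ _

theorem tensorCoord_swapHead (f g : H) (fs : List H) (l : List ι) :
    tensorCoord b (f :: g :: fs) (swapHead l) = tensorCoord b (g :: f :: fs) l := by
  match l with
  | [] => rfl
  | [_] => simp [swapHead, tensorCoord]
  | _ :: _ :: _ => simp only [swapHead, tensorCoord]; ring

/-- The components of a symmetric tensor along elementary tensors are symmetric. -/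
theorem inner_tensor_perm {fs gs : List H} (h : fs.Perm gs) {x : FullFock ι} (hx : x ∈ Fock ι) :
    inner ℂ (tensor b fs) x = inner ℂ (tensor b gs) x := by
  induction h generalizing x with
  | nil => rfl
  | cons f _ ih =>
    rw [inner_tensor_cons, inner_tensor_cons]
    exact ih (contraction_mem_fock b f hx)
  | swap f g fs =>
    rw [lp.inner_eq_tsum, lp.inner_eq_tsum, ← (swapHead_involutive (ι := ι)).toPerm.tsum_eq]
    refine tsum_congr fun l => ?_
    have h1 : x (swapHead l) = x l := hx _ _ (perm_swapHead l)
    have h2 : tensor b (g :: f :: fs) (swapHead l) = tensor b (f :: g :: fs) l :=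
      tensorCoord_swapHead b g f fs l
    change inner ℂ (tensor b (g :: f :: fs) (swapHead l)) (x (swapHead l)) = _
    rw [h1, h2]
  | trans _ _ ih1 ih2 => rw [ih1 hx, ih2 hx]

theorem inner_tensor_nil_cons (f : H) (fs : List H) :
    inner ℂ (tensor b []) (tensor b (f :: fs)) = 0 := by
  rw [lp.inner_eq_tsum]
  refine (tsum_congr fun l => ?_).trans tsum_zero
  cases l with
  | nil => simp [tensor, tensorCoord]
  | cons i l => simp [tensor, tensorCoord]

theorem inner_tensor_nil (x : FullFock ι) : inner ℂ (tensor b []) x = x [] := by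
  rw [lp.inner_eq_tsum, tsum_eq_single []]
  · simp [tensor, tensorCoord]
  · intro l hl
    cases l with
    | nil => exact absurd rfl hl
    | cons i l => simp [tensor, tensorCoord]

theorem inner_tensor_map_map (V : H ≃ₗᵢ[ℂ] H) (fs gs : List H) :
    inner ℂ (tensor b (fs.map V)) (tensor b (gs.map V)) = inner ℂ (tensor b fs) (tensor b gs) := by
  induction fs generalizing gs with
  | nil =>
    cases gs with
    | nil => rfl
    | cons g gs => simp only [List.map_nil, List.map_cons, inner_tensor_nil_cons]
  | cons f fs ih =>
    cases gs with
    | nil =>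
      rw [← inner_conj_symm, ← inner_conj_symm (tensor b (f :: fs))]
      simp only [List.map_nil, List.map_cons, inner_tensor_nil_cons]
    | cons g gs =>
      simp only [List.map_cons, tensor_cons, creation_apply, inner_consTensor, ih,
        LinearIsometryEquiv.inner_map_map]

theorem contraction_basis (i : ι) (x : FullFock ι) (l : List ι) :
    contraction b (b i) x l = x (i :: l) := by
  classical
  rw [contraction_apply, tsum_eq_single i]
  · simp [b.orthonormal.norm_eq_one]
  · intro j hj
    rw [b.orthonormal.inner_eq_zero hj.symm, zero_mul]

theorem inner_tensor_basis (l : List ι) (x : FullFock ι) :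
    inner ℂ (tensor b (l.map b)) x = x l := by
  induction l generalizing x with
  | nil => exact inner_tensor_nil b x
  | cons i l ih => rw [List.map_cons, inner_tensor_cons, ih, contraction_basis]

theorem tensor_basis [DecidableEq ι] (l : List ι) :
    tensor b (l.map b) = (lp.single 2 l (1 : ℂ) : FullFock ι) := by
  refine ext_inner_right ℂ fun x => ?_
  rw [inner_tensor_basis, lp.inner_single_left]
  simp

theorem orthonormal_tensor_map (V : H ≃ₗᵢ[ℂ] H) :
    Orthonormal ℂ fun l : List ι => tensor b (l.map fun i => V (b i)) := by
  classical
  rw [orthonormal_iff_ite]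
  intro l l'
  have e : ∀ l : List ι, (l.map fun i => V (b i)) = (l.map b).map V := fun l => by simp
  rw [e, e, inner_tensor_map_map, inner_tensor_basis, tensor_basis, lp.single_apply,
    Pi.single_apply]

theorem eq_zero_of_inner_basis_eq_zero {v : ι → H} (hv : Dense (Submodule.span ℂ (Set.range v) : Set H))
    {T : H →L[ℂ] FullFock ι} {x : FullFock ι} (h : ∀ i, inner ℂ (T (v i)) x = 0) (f : H) :
    inner ℂ (T f) x = 0 := by
  have h1 : Submodule.span ℂ (Set.range v) ≤ LinearMap.ker
      ((innerSL ℂ x : FullFock ι →L[ℂ] ℂ) ∘L T : H →L[ℂ] ℂ).toLinearMap := by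
    rw [Submodule.span_le]
    rintro _ ⟨i, rfl⟩
    simp only [SetLike.mem_coe, LinearMap.mem_ker]
    change inner ℂ x (T (v i)) = 0
    rw [← inner_conj_symm, h, map_zero]
  have h2 : (fun f => inner ℂ x (T f)) = fun _ => 0 :=
    Continuous.ext_on hv (by fun_prop) continuous_const fun f hf => h1 hf
  rw [← inner_conj_symm, congrFun h2 f, map_zero]

/-- Totality of the tensors V b_{i₁} ⊗ ⋯ ⊗ V b_{iₙ}, one factor at a time: the vectors V b_i are
total in `H`, and contracting the first factor lowers the degree. -/
theorem eq_zero_of_inner_tensor_map_eq_zero (V : H ≃ₗᵢ[ℂ] H) (n : ℕ) (x : FullFock ι)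
    (hx : ∀ l : List ι, l.length = n → inner ℂ (tensor b (l.map fun i => V (b i))) x = 0)
    (l : List ι) (hl : l.length = n) : x l = 0 := by
  have hd : Dense (Submodule.span ℂ (Set.range fun i => V (b i)) : Set H) := by
    have h1 : Dense (V '' (Submodule.span ℂ (Set.range b) : Set H)) :=
      V.surjective.denseRange.dense_image V.continuous
        (dense_iff_closure_eq.2 (by
          have := b.dense_span
          rw [← Submodule.topologicalClosure_coe, this]; rfl))
    refine h1.mono ?_
    rintro _ ⟨y, hy, rfl⟩
    have : V y ∈ (Submodule.span ℂ (Set.range b)).map (V.toLinearEquiv : H →ₗ[ℂ] H) :=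
      ⟨y, hy, rfl⟩
    rw [Submodule.map_span, ← Set.range_comp] at this
    exact this
  induction n generalizing x l with
  | zero =>
    have h := hx [] rfl
    rw [List.length_eq_zero_iff] at hl
    subst hl
    rwa [List.map_nil, inner_tensor_nil] at h
  | succ n ih =>
    obtain ⟨i, l, rfl⟩ : ∃ i l', l = i :: l' := by
      cases l with
      | nil => simp at hl
      | cons i l => exact ⟨i, l, rfl⟩
    have h1 : ∀ j, contraction b (V (b j)) x l = 0 := fun j =>
      ih _ (fun l' hl' => by
        have := hx (j :: l') (by simp [hl'])
        rwa [List.map_cons, inner_tensor_cons] at this) l (by simpa using hl)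
    -- By induction only the first factor is still rotated by `V`; totality of the V b_j allows it
    -- to be replaced by b_i.
    have h2 := eq_zero_of_inner_basis_eq_zero (ι := ι) hd
      (T := (creation b).flip (tensor b (l.map b))) (x := x) (fun j => by
        rw [ContinuousLinearMap.flip_apply, ← tensor_cons, inner_tensor_cons, inner_tensor_basis,
          h1]) (b i)
    rwa [ContinuousLinearMap.flip_apply, ← tensor_cons, ← List.map_cons, inner_tensor_basis] at h2

/-- The Hilbert basis of the tensors `V b_{i₁} ⊗ ⋯ ⊗ V b_{iₙ}`. -/
def tensorBasis (V : H ≃ₗᵢ[ℂ] H) : HilbertBasis (List ι) ℂ (FullFock ι) :=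
  HilbertBasis.mkOfOrthogonalEqBot (orthonormal_tensor_map b V) (by
    rw [Submodule.eq_bot_iff]
    intro x hx
    rw [Submodule.mem_orthogonal] at hx
    ext l
    exact eq_zero_of_inner_tensor_map_eq_zero b V l.length x
      (fun l' _ => hx _ (Submodule.subset_span ⟨l', rfl⟩)) l rfl)

theorem tensorBasis_repr_apply (V : H ≃ₗᵢ[ℂ] H) (x : FullFock ι) (l : List ι) :
    (tensorBasis b V).repr x l = inner ℂ (tensor b (l.map fun i => V (b i))) x := by
  rw [HilbertBasis.repr_apply_apply, tensorBasis, HilbertBasis.coe_mkOfOrthogonalEqBot]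

/-- `y = Γ(V)⁻¹ x`, where `Γ(V)` is the second quantization of the unitary operator `V`,
tested on elementary tensors. -/
def IsTensorPullback (V : H → H) (x y : FullFock ι) : Prop :=
  ∀ fs : List H, inner ℂ (tensor b (fs.map V)) x = inner ℂ (tensor b fs) y

/-- This is the unitarity of Γ(V), obtained without constructing Γ(V): the coordinates of `x` in the
rotated tensor basis are those of `x'` in the standard one, and Parseval applies to both. -/
theorem IsTensorPullback.inner_eq {V : H ≃ₗᵢ[ℂ] H} {x x' y y' : FullFock ι}
    (hx : IsTensorPullback b V x x') (hy : IsTensorPullback b V y y') :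
    inner ℂ x y = inner ℂ x' y' := by
  have key : ∀ {z z'}, IsTensorPullback b V z z' → (tensorBasis b V).repr z = z' := by
    intro z z' hz
    refine lp.ext (funext fun l => ?_)
    have := hz (l.map b)
    rw [List.map_map, inner_tensor_basis] at this
    rw [tensorBasis_repr_apply]
    exact this
  rw [← (tensorBasis b V).repr.inner_map_map, key hx, key hy]

/-! ### Derivatives of tensor powers -/

/-- The derivative of `φ^{⊗n}` in the direction of `ψ`. -/
def tensorPowDeriv (φ ψ : H) : ℕ → FullFock ι
  | 0 => 0
  | n + 1 => creation b φ (tensorPowDeriv φ ψ n) + creation b ψ (tensor b (List.replicate n φ))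

theorem hasDerivAt_tensor_replicate {w : ℝ → H} {w' : H} {s : ℝ} (hw : HasDerivAt w w' s) (n : ℕ) :
    HasDerivAt (fun s => (tensor b (List.replicate n (w s)) : FullFock ι)) (tensorPowDeriv b (w s) w' n) s := by
  induction n with
  | zero => exact hasDerivAt_const s (tensor b [])
  | succ n ih =>
    simp only [List.replicate_succ, tensor_cons, tensorPowDeriv]
    exact ((creation b).bilinearRestrictScalars ℝ).hasDerivAt_of_bilinear (fun _ => hw) fun _ => ih

/-- The n terms of the Leibniz rule differ only by the position of `ψ`, which a symmetric tensor
does not see. -/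
theorem inner_tensorPowDeriv (φ ψ : H) (n : ℕ) {x : FullFock ι} (hx : x ∈ Fock ι) :
    inner ℂ (tensorPowDeriv b φ ψ n) x =
      n * inner ℂ (tensor b (ψ :: List.replicate (n - 1) φ)) x := by
  induction n generalizing x with
  | zero => simp [tensorPowDeriv]
  | succ n ih =>
    rw [tensorPowDeriv, inner_add_left, ← tensor_cons, ← ContinuousLinearMap.adjoint_inner_right]
    change inner ℂ (tensorPowDeriv b φ ψ n) (contraction b φ x) + _ = _
    rw [ih (contraction_mem_fock b φ hx), ← inner_tensor_cons]
    cases n with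
    | zero => simp
    | succ n =>
      rw [inner_tensor_perm b (List.Perm.swap ψ φ _) hx, Nat.add_sub_cancel, Nat.add_sub_cancel,
        ← List.replicate_succ]
      push_cast
      ring

theorem tmul_tensor (fs gs : List H) :
    tmul fs.length (tensor b fs) (tensor b gs) = tensor b (fs ++ gs) := by
  refine lp.ext (funext fun l => ?_)
  change tensorCoord b fs (l.take _) * tensorCoord b gs (l.drop _) = tensorCoord b (fs ++ gs) l
  induction fs generalizing l with
  | nil => simp [tensorCoord]
  | cons f fs ih =>
    cases l with
    | nil => simp [tensorCoord]
    | cons i l => simp [tensorCoord, ← ih, mul_assoc]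

/-- A tensor power is its own symmetrization, so it can be differentiated in the full Fock space and
then projected. The derivative is written as in `secondQuantization`, with `w'` in place of `P w`.
-/
theorem hasDerivAt_tensorPow {w : ℝ → H} {w' : H} {s : ℝ} (hw : HasDerivAt w w' s) (n : ℕ) :
    HasDerivAt (fun s => tensorPow b n (w s))
      ((n : ℂ) • symmetrize (tmul (n - 1) (tensorPow b (n - 1) (w s) : Fock ι) (tensor b [w']))) s := by
  have h1 := hasDerivAt_tensor_replicate b hw n
  have h2 := (((Fock ι).orthogonalProjectionOnto).restrictScalars ℝ).hasFDerivAt.comp_hasDerivAt s h1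
  have e1 : (fun s => tensorPow b n (w s)) = (((Fock ι).orthogonalProjectionOnto).restrictScalars ℝ) ∘
      fun s => tensor b (List.replicate n (w s)) := by
    funext s
    exact ((Fock ι).orthogonalProjectionOnto_mem_subspace_eq_self (tensorPow b n (w s))).symm
  rw [e1]
  refine h2.congr_deriv (Eq.symm ?_)
  change _ = (Fock ι).orthogonalProjectionOnto _
  refine ext_inner_right ℂ fun x => ?_
  rw [inner_smul_left, symmetrize, Submodule.inner_orthogonalProjectionOnto_eq_of_mem_right]
  rw [Submodule.inner_orthogonalProjectionOnto_eq_of_mem_right, inner_tensorPowDeriv b _ _ _ x.2]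
  have e2 := tmul_tensor b (List.replicate (n - 1) (w s)) [w']
  rw [List.length_replicate] at e2
  change starRingEnd ℂ _ * inner ℂ (tmul (n - 1) (tensor b (List.replicate (n - 1) (w s))) _) _ = _
  rw [e2, inner_tensor_perm b List.perm_append_comm x.2]
  simp

/-- Polarization by differentiation: replacing φ by φ + r f and differentiating at r = 0 frees one
factor, which is then contracted away. Induction on the number of factors frees the others. -/
theorem isTensorPullback_of_replicate (V : H →ₗ[ℂ] H) {x y : FullFock ι} (hx : x ∈ Fock ι)
    (hy : y ∈ Fock ι) (h : ∀ n φ, inner ℂ (tensor b (List.replicate n (V φ))) x =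
      inner ℂ (tensor b (List.replicate n φ)) y) : IsTensorPullback b V x y := by
  suffices ∀ (fs : List H) (x y : FullFock ι), x ∈ Fock ι → y ∈ Fock ι →
      (∀ φ, inner ℂ (tensor b (List.replicate fs.length (V φ))) x =
        inner ℂ (tensor b (List.replicate fs.length φ)) y) →
      inner ℂ (tensor b (fs.map V)) x = inner ℂ (tensor b fs) y from
    fun fs => this fs x y hx hy (h _)
  intro fs
  induction fs with
  | nil => exact fun x y _ _ h => h 0
  | cons f fs ih =>
    intro x y hx hy h
    rw [List.map_cons, inner_tensor_cons, inner_tensor_cons]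
    refine ih _ _ (contraction_mem_fock b _ hx) (contraction_mem_fock b _ hy) fun φ => ?_
    have d : ∀ φ f : H, HasDerivAt (fun r : ℝ => φ + r • f) f 0 := fun φ f => by
      simpa using ((hasDerivAt_id (0 : ℝ)).smul_const f).const_add φ
    have d1 := (hasDerivAt_tensor_replicate b (d (V φ) (V f)) (fs.length + 1)).inner ℂ
      (hasDerivAt_const (0 : ℝ) x)
    have d2 := (hasDerivAt_tensor_replicate b (d φ f) (fs.length + 1)).inner ℂ
      (hasDerivAt_const (0 : ℝ) y)
    have e : (fun r : ℝ => inner ℂ (tensor b (List.replicate (fs.length + 1) (V φ + r • V f))) x) =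
        fun r : ℝ => inner ℂ (tensor b (List.replicate (fs.length + 1) (φ + r • f))) y := by
      funext r
      have h0 : V (r • f) = r • V f := by
        rw [← Complex.coe_smul, map_smul, Complex.coe_smul]
      have h1 := h (φ + r • f)
      rw [map_add, h0] at h1
      exact h1
    rw [e] at d1
    have h1 := d1.unique d2
    simp only [inner_zero_right, zero_add, zero_smul, add_zero, inner_tensorPowDeriv b _ _ _ hx,
      inner_tensorPowDeriv b _ _ _ hy, Nat.add_sub_cancel, inner_tensor_cons] at h1
    exact mul_left_cancel₀ (Nat.cast_ne_zero.2 (Nat.succ_ne_zero _)) h1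

theorem tensorCoord_eq_zero {fs : List H} {l : List ι} (h : l.length ≠ fs.length) :
    tensorCoord b fs l = 0 := by
  induction fs generalizing l with
  | nil =>
    cases l with
    | nil => exact absurd rfl h
    | cons i l => rfl
  | cons f fs ih =>
    cases l with
    | nil => rfl
    | cons i l =>
      simp only [tensorCoord]
      rw [ih (by simpa using h), mul_zero]

theorem inner_tensor_annihilation {f : H} {x y : Fock ι} (h : IsAnnihilation b f x y)
    (fs : List H) : inner ℂ (tensor b fs) (y : FullFock ι) =
      (Real.sqrt (fs.length + 1) : ℂ) * inner ℂ (tensor b (f :: fs)) (x : FullFock ι) := by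
  rw [inner_tensor_cons, lp.inner_eq_tsum, lp.inner_eq_tsum, ← tsum_mul_left]
  refine tsum_congr fun l => ?_
  rw [(isAnnihilation_iff b f x y).1 h l]
  by_cases hl : l.length = fs.length
  · rw [hl]
    simp only [RCLike.inner_apply]
    ring
  · have : tensor b fs l = 0 := tensorCoord_eq_zero b hl
    simp [this]

/-- The relation Γ(V)⁻¹ a(Vf) Γ(V) = a(f): contracting with Vf means adding the factor Vf to the
test tensor, and this factor is pulled back together with the others. -/
theorem IsTensorPullback.annihilation {V : H → H} {f : H} {x x' y y' : Fock ι}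
    (hx : IsTensorPullback b V (x : FullFock ι) x') (hy : IsAnnihilation b (V f) x y)
    (hy' : IsAnnihilation b f x' y') : IsTensorPullback b V (y : FullFock ι) y' := by
  intro fs
  rw [inner_tensor_annihilation b hy, inner_tensor_annihilation b hy', ← hx (f :: fs)]
  simp

end Creation

/-! ### Wave packets: automatic boundedness and weak convergence -/

section Packets

variable {J ι : Type*} [Fintype J] {μ : Measure (J → ℝ)}

namespace IsAmplitude

theorem indicator_of_le {S : Set (J → ℝ)} (hS : Bornology.IsBounded S)
    (hμ : μ S < ⊤) {g : (J → ℝ) → ℂ} (hg : Measurable g) (hgS : Function.support g ⊆ S) {C : ℝ}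
    (hC : ∀ p, ‖g p‖ ≤ C) : IsAmplitude μ g :=
  ⟨hg, ⟨C, hC⟩, hS.subset hgS, (measure_mono hgS).trans_lt hμ⟩

theorem indicator_one {S : Set (J → ℝ)} (hSm : MeasurableSet S) (hS : Bornology.IsBounded S)
    (hμ : μ S < ⊤) : IsAmplitude μ (S.indicator fun _ => 1) :=
  indicator_of_le hS hμ (measurable_const.indicator hSm) Set.support_indicator_subset (C := 1)
    fun p => by by_cases hp : p ∈ S <;> simp [hp]

theorem mul {g u : (J → ℝ) → ℂ} (hg : IsAmplitude μ g) (hu : Measurable u)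
    (hub : ∀ R : ℝ, ∃ C, ∀ p, ‖p‖ ≤ R → ‖u p‖ ≤ C) : IsAmplitude μ fun p => u p * g p := by
  obtain ⟨R, hR⟩ := hg.bounded_support.exists_norm_le
  obtain ⟨C, hC⟩ := hub R
  obtain ⟨D, hD⟩ := hg.bounded
  have hs : Function.support (fun p => u p * g p) ⊆ Function.support g :=
    Function.support_mul_subset_right u g
  refine ⟨hu.mul hg.measurable, ⟨max C 0 * D, fun p => ?_⟩, hg.bounded_support.subset hs,
    (measure_mono hs).trans_lt hg.finite_support⟩
  by_cases hp : g p = 0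
  · rw [hp, mul_zero, norm_zero]
    exact mul_nonneg (le_max_right _ _) ((norm_nonneg _).trans (hD p))
  · rw [norm_mul]
    exact mul_le_mul ((hC p (hR p hp)).trans (le_max_left _ _)) (hD p) (norm_nonneg _)
      (le_max_right _ _)

theorem phase_mul {g : (J → ℝ) → ℂ} (hg : IsAmplitude μ g) {u : (J → ℝ) → ℝ} (hu : Measurable u) :
    IsAmplitude μ fun p => Complex.exp (u p * Complex.I) * g p :=
  hg.mul (by fun_prop) fun _ => ⟨1, fun p _ => by rw [Complex.norm_exp_ofReal_mul_I]⟩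

theorem const_mul {g : (J → ℝ) → ℂ} (hg : IsAmplitude μ g) (c : ℂ) :
    IsAmplitude μ fun p => c * g p :=
  hg.mul measurable_const fun _ => ⟨‖c‖, fun _ _ => le_rfl⟩

theorem sub {g g' : (J → ℝ) → ℂ} (hg : IsAmplitude μ g) (hg' : IsAmplitude μ g') :
    IsAmplitude μ fun p => g p - g' p := by
  obtain ⟨C, hC⟩ := hg.bounded
  obtain ⟨D, hD⟩ := hg'.bounded
  refine indicator_of_le (hg.bounded_support.union hg'.bounded_support)
    ((measure_union_le _ _).trans_lt (ENNReal.add_lt_top.2 ⟨hg.finite_support, hg'.finite_support⟩))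
    (hg.measurable.sub hg'.measurable) (Function.support_sub g g') (C := C + D)
    fun p => (norm_sub_le _ _).trans (add_le_add (hC p) (hD p))

end IsAmplitude

namespace KetFamily

variable (K : KetFamily μ ι)

theorem packet_apply (g : {g // IsAmplitude μ g}) (l : List ι) :
    (K.packet g : FullFock ι) l = ∫ p, g.1 p * K.ket p l ∂μ := rfl

theorem packet_sub (g g' : {g // IsAmplitude μ g}) :
    K.packet ⟨_, g.2.sub g'.2⟩ = K.packet g - K.packet g' := by
  refine Subtype.ext (lp.ext (funext fun l => ?_))
  change (K.packet _ : FullFock ι) l = (K.packet g : FullFock ι) l - (K.packet g' : FullFock ι) l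
  simp only [packet_apply, sub_mul]
  exact integral_sub (K.integrable _ g.2 l) (K.integrable _ g'.2 l)

theorem packet_const_mul (c : ℂ) (g : {g // IsAmplitude μ g}) :
    K.packet ⟨_, g.2.const_mul c⟩ = c • K.packet g := by
  refine Subtype.ext (lp.ext (funext fun l => ?_))
  change (K.packet _ : FullFock ι) l = c * (K.packet g : FullFock ι) l
  simp only [packet_apply, mul_assoc, integral_const_mul]

section Bound

variable {S : Set (J → ℝ)} (hSm : MeasurableSet S) (hS : Bornology.IsBounded S) (hμ : μ S < ⊤)

include hSm hS hμ in
theorem integrableOn_ket (l : List ι) : IntegrableOn (fun p => K.ket p l) S μ := by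
  rw [← integrable_indicator_iff hSm]
  refine (K.integrable _ (IsAmplitude.indicator_one hSm hS hμ) l).congr (Eventually.of_forall
    fun p => ?_)
  by_cases hp : p ∈ S <;> simp [hp]

-- Amplitudes are bounded at every point, elements of L^∞ only almost everywhere; so the
-- representative is set to zero where it exceeds its norm.
include hSm hS hμ in
theorem exists_amplitude (f : Lp ℂ ∞ (μ.restrict S)) :
    ∃ g : {g // IsAmplitude μ g}, (∀ p, p ∉ S → g.1 p = 0) ∧ f =ᵐ[μ.restrict S] g.1 := by
  have hf : Measurable f := (Lp.stronglyMeasurable f).measurable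
  have hb : ∀ᵐ p ∂(μ.restrict S), ‖f p‖ ≤ ‖f‖ := by
    filter_upwards [enorm_ae_le_eLpNormEssSup f (μ.restrict S)] with p hp
    rw [Lp.norm_def, ← eLpNorm_exponent_top] at *
    rw [← toReal_enorm]
    exact ENNReal.toReal_mono (Lp.eLpNorm_ne_top f) hp
  have hA : MeasurableSet (S ∩ {p | ‖f p‖ ≤ ‖f‖}) :=
    hSm.inter (measurableSet_le hf.norm measurable_const)
  refine ⟨⟨(S ∩ {p | ‖f p‖ ≤ ‖f‖}).indicator f, IsAmplitude.indicator_of_le hS hμ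
    (hf.indicator hA) (Set.support_indicator_subset.trans Set.inter_subset_left) (C := ‖f‖)
    fun p => ?_⟩, fun p hp => Set.indicator_of_notMem (fun h => hp h.1) _, ?_⟩
  · by_cases hp : p ∈ S ∩ {p | ‖f p‖ ≤ ‖f‖}
    · rw [Set.indicator_of_mem hp]; exact hp.2
    · rw [Set.indicator_of_notMem hp, norm_zero]; exact norm_nonneg _
  · filter_upwards [hb, ae_restrict_mem hSm] with p hp hpS
    exact (Set.indicator_of_mem (show p ∈ S ∩ {p | ‖f p‖ ≤ ‖f‖} from ⟨hpS, hp⟩) f).symm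

theorem setIntegral_eq_packet {f : (J → ℝ) → ℂ} (g : {g // IsAmplitude μ g})
    (h0 : ∀ p, p ∉ S → g.1 p = 0) (hfg : f =ᵐ[μ.restrict S] g.1) (l : List ι) :
    ∫ p in S, f p * K.ket p l ∂μ = (K.packet g : FullFock ι) l := by
  have h1 : ∫ p in S, g.1 p * K.ket p l ∂μ = ∫ p, g.1 p * K.ket p l ∂μ :=
    setIntegral_eq_integral_of_forall_compl_eq_zero fun p hp => by rw [h0 p hp, zero_mul]
  rw [packet_apply, ← h1]
  exact integral_congr_ae (hfg.mono fun p hp => by simp only [hp])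

include hSm hS hμ in
theorem integrable_lp_mul_ket (f : Lp ℂ ∞ (μ.restrict S)) (l : List ι) :
    Integrable (fun p => f p * K.ket p l) (μ.restrict S) := by
  obtain ⟨g, _, hg⟩ := exists_amplitude hSm hS hμ f
  exact ((K.integrable _ g.2 l).restrict).congr (hg.mono fun p hp => by simp only [hp])

/-- The wave packets with bounded measurable amplitudes on a bounded set of finite measure. -/
def lpPacket : Lp ℂ ∞ (μ.restrict S) →ₗ[ℂ] FullFock ι where
  toFun f := ⟨fun l => ∫ p in S, f p * K.ket p l ∂μ, by
    obtain ⟨g, h0, hg⟩ := exists_amplitude hSm hS hμ f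
    simp only [K.setIntegral_eq_packet g h0 hg]
    exact (K.packet g : FullFock ι).2⟩
  map_add' f g := by
    refine lp.ext (funext fun l => ?_)
    change ∫ p in S, (f + g) p * K.ket p l ∂μ =
      ∫ p in S, f p * K.ket p l ∂μ + ∫ p in S, g p * K.ket p l ∂μ
    rw [← integral_add (K.integrable_lp_mul_ket hSm hS hμ f l)
      (K.integrable_lp_mul_ket hSm hS hμ g l)]
    refine integral_congr_ae ((Lp.coeFn_add f g).mono fun p hp => ?_)
    simp only [hp, Pi.add_apply, add_mul]
  map_smul' c f := by
    refine lp.ext (funext fun l => ?_)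
    change ∫ p in S, (c • f) p * K.ket p l ∂μ = c * ∫ p in S, f p * K.ket p l ∂μ
    rw [← integral_const_mul]
    refine integral_congr_ae ((Lp.coeFn_smul c f).mono fun p hp => ?_)
    simp only [hp, Pi.smul_apply, smul_eq_mul, mul_assoc]

theorem lpPacket_apply (f : Lp ℂ ∞ (μ.restrict S)) (l : List ι) :
    K.lpPacket hSm hS hμ f l = ∫ p in S, f p * K.ket p l ∂μ := rfl

theorem norm_lpPacket_apply_le (f : Lp ℂ ∞ (μ.restrict S)) (l : List ι) :
    ‖K.lpPacket hSm hS hμ f l‖ ≤ ‖f‖ * ∫ p in S, ‖K.ket p l‖ ∂μ := by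
  rw [lpPacket_apply, ← integral_const_mul]
  refine norm_integral_le_of_norm_le ((K.integrableOn_ket hSm hS hμ l).norm.const_mul _) ?_
  filter_upwards [enorm_ae_le_eLpNormEssSup f (μ.restrict S)] with p hp
  rw [norm_mul]
  refine mul_le_mul_of_nonneg_right ?_ (norm_nonneg _)
  rw [Lp.norm_def, ← toReal_enorm]
  rw [← eLpNorm_exponent_top] at hp
  exact ENNReal.toReal_mono (Lp.eLpNorm_ne_top f) hp

/-- A ket family assumes that packets are square summable, but with no bound. Each coordinate is
continuous in the amplitude, so the map from L^∞ to ℓ² has a closed graph, and the closed graph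
theorem supplies the bound. -/
theorem continuous_lpPacket : Continuous (K.lpPacket hSm hS hμ) := by
  have hc : ∀ l : List ι, Continuous fun x : FullFock ι => x l := fun l =>
    (continuous_apply l).comp (lp.uniformContinuous_coe (p := 2)).continuous
  refine LinearMap.continuous_of_seq_closed_graph _ fun u x y hu hy => lp.ext (funext fun l => ?_)
  refine tendsto_nhds_unique (((hc l).tendsto y).comp hy) ?_
  rw [tendsto_iff_norm_sub_tendsto_zero] at hu ⊢
  refine squeeze_zero (fun _ => norm_nonneg _) (fun n => ?_)
    (by simpa using hu.mul_const (∫ p in S, ‖K.ket p l‖ ∂μ))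
  have := K.norm_lpPacket_apply_le hSm hS hμ (u n - x) l
  rw [map_sub] at this
  exact this

include hSm hS hμ in
/-- Wave packets on a fixed bounded set of finite measure are bounded by the supremum of the
amplitude. -/
theorem exists_norm_packet_le : ∃ C : ℝ, 0 ≤ C ∧ ∀ (g : {g // IsAmplitude μ g}) (D : ℝ),
    (∀ p, p ∉ S → g.1 p = 0) → (∀ p, ‖g.1 p‖ ≤ D) → ‖K.packet g‖ ≤ C * D := by
  let T : Lp ℂ ∞ (μ.restrict S) →L[ℂ] FullFock ι :=
    ⟨K.lpPacket hSm hS hμ, K.continuous_lpPacket hSm hS hμ⟩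
  refine ⟨‖T‖, norm_nonneg _, fun g D h0 hD => ?_⟩
  have hD0 : 0 ≤ D := (norm_nonneg _).trans (hD 0)
  have hm : MemLp g.1 ∞ (μ.restrict S) :=
    memLp_top_of_bound g.2.measurable.aestronglyMeasurable D (Eventually.of_forall hD)
  have e : T (hm.toLp g.1) = (K.packet g : FullFock ι) :=
    lp.ext (funext fun l => K.setIntegral_eq_packet g h0 hm.coeFn_toLp l)
  change ‖(K.packet g : FullFock ι)‖ ≤ _
  rw [← e]
  refine (T.le_opNorm _).trans (mul_le_mul_of_nonneg_left ?_ (norm_nonneg _))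
  rw [Lp.norm_toLp]
  refine ENNReal.toReal_le_of_le_ofReal hD0 ?_
  rw [eLpNorm_exponent_top]
  exact eLpNormEssSup_le_of_ae_bound (Eventually.of_forall hD)

end Bound

end KetFamily

/-- In `ℓ²`, boundedness and convergence of the coordinates imply weak convergence. -/
theorem tendsto_inner_of_tendsto_apply {α : Type*} {F : Filter α} {y : α → FullFock ι}
    {z : FullFock ι} {C : ℝ} (hC : ∀ᶠ a in F, ‖y a‖ ≤ C)
    (h : ∀ l, Tendsto (fun a => y a l) F (𝓝 (z l))) (x : FullFock ι) :
    Tendsto (fun a => inner ℂ x (y a)) F (𝓝 (inner ℂ x z)) := by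
  classical
  rw [Metric.tendsto_nhds]
  intro δ hδ
  have hpos : 0 < |C| + ‖z‖ + 1 := by positivity
  -- Finitely many coordinates of `x` suffice: the tail is paired with `y a - z`, whose norm is at
  -- most |C| + ‖z‖ + 1, and so contributes at most δ/2.
  obtain ⟨s, hs⟩ := ((lp.hasSum_single ENNReal.ofNat_ne_top x).eventually
    (Metric.ball_mem_nhds x (div_pos (half_pos hδ) hpos))).exists
  have hlim : Tendsto (fun a => inner ℂ (∑ l ∈ s, (lp.single 2 l (x l) : FullFock ι)) (y a)) F
      (𝓝 (inner ℂ (∑ l ∈ s, (lp.single 2 l (x l) : FullFock ι)) z)) := by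
    simp only [sum_inner, lp.inner_single_left]
    exact tendsto_finsetSum _ fun l _ => (tendsto_const_nhds.inner (h l))
  filter_upwards [hC, Metric.tendsto_nhds.1 hlim _ (half_pos hδ)] with a ha hd
  generalize (∑ l ∈ s, (lp.single 2 l (x l) : FullFock ι)) = w at hs hd
  rw [dist_eq_norm] at hd ⊢
  have hs' : ‖x - w‖ < δ / 2 / (|C| + ‖z‖ + 1) := by
    rw [← dist_eq_norm, dist_comm]; exact hs
  have e : inner ℂ x (y a) - inner ℂ x z =
      inner ℂ (x - w) (y a - z) + (inner ℂ w (y a) - inner ℂ w z) := by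
    simp only [inner_sub_left, inner_sub_right]; ring
  have h1 : ‖inner ℂ (x - w) (y a - z)‖ ≤ δ / 2 := by
    refine (norm_inner_le_norm _ _).trans ?_
    have h2 : ‖y a - z‖ ≤ |C| + ‖z‖ + 1 := by
      have := norm_sub_le (y a) z
      have := le_abs_self C
      linarith
    calc ‖x - w‖ * ‖y a - z‖ ≤ δ / 2 / (|C| + ‖z‖ + 1) * (|C| + ‖z‖ + 1) :=
          mul_le_mul hs'.le h2 (norm_nonneg _) (by positivity)
      _ = δ / 2 := by field_simp
  rw [e]
  linarith [norm_add_le (inner ℂ (x - w) (y a - z)) (inner ℂ w (y a) - inner ℂ w z)]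

namespace KetFamily

variable (K : KetFamily μ ι)

/-- Dominated convergence for wave packets, in the weak topology. -/
theorem tendsto_inner_packet {S : Set (J → ℝ)} (hSm : MeasurableSet S)
    (hS : Bornology.IsBounded S) (hμ : μ S < ⊤) {α : Type*} {F : Filter α}
    [F.IsCountablyGenerated] {g : α → {g // IsAmplitude μ g}} {g' : {g // IsAmplitude μ g}} {D : ℝ}
    (h0 : ∀ a p, p ∉ S → (g a).1 p = 0) (hD : ∀ᶠ a in F, ∀ p, ‖(g a).1 p‖ ≤ D)
    (h : ∀ p, Tendsto (fun a => (g a).1 p) F (𝓝 (g'.1 p))) (x : Fock ι) :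
    Tendsto (fun a => inner ℂ x (K.packet (g a))) F (𝓝 (inner ℂ x (K.packet g'))) := by
  obtain ⟨C, _, hC⟩ := K.exists_norm_packet_le hSm hS hμ
  refine tendsto_inner_of_tendsto_apply (C := C * D)
    (y := fun a => (K.packet (g a) : FullFock ι)) (z := K.packet g')
    (hD.mono fun a ha => hC (g a) D (h0 a) ha) (fun l => ?_) x
  simp only [packet_apply]
  refine tendsto_integral_filter_of_dominated_convergence
    (S.indicator fun p => |D| * ‖K.ket p l‖)
    (Eventually.of_forall fun a => (K.integrable _ (g a).2 l).aestronglyMeasurable)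
    (hD.mono fun a ha => Eventually.of_forall fun p => ?_) ?_
    (Eventually.of_forall fun p => (h p).mul_const _)
  · by_cases hp : p ∈ S
    · rw [Set.indicator_of_mem hp, norm_mul]
      exact mul_le_mul_of_nonneg_right ((ha p).trans (le_abs_self D)) (norm_nonneg _)
    · rw [Set.indicator_of_notMem hp, h0 a p hp, zero_mul, norm_zero]
  · rw [integrable_indicator_iff hSm]
    exact (K.integrableOn_ket hSm hS hμ l).norm.const_mul _

end KetFamily

end Packets

/-! The inner product of the Fock space is that of the full Fock space. -/

namespace Fock

variable {ι : Type*} (x y z : Fock ι) (c : ℂ)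

theorem inner_add_left : inner ℂ (x + y) z = inner ℂ x z + inner ℂ y z := _root_.inner_add_left x y z

theorem inner_sub_right : inner ℂ x (y - z) = inner ℂ x y - inner ℂ x z :=
  _root_.inner_sub_right x y z

theorem inner_smul_left : inner ℂ (c • x) y = starRingEnd ℂ c * inner ℂ x y :=
  _root_.inner_smul_left x y c

theorem inner_smul_right : inner ℂ x (c • y) = c * inner ℂ x y := _root_.inner_smul_right x y c

theorem inner_smul_left_real (r : ℝ) : inner ℂ (r • x) y = r * inner ℂ x y := by
  have h : r • x = (r : ℂ) • x := rfl
  rw [h, inner_smul_left, Complex.conj_ofReal]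

theorem inner_zero_left : inner ℂ (0 : Fock ι) x = 0 := _root_.inner_zero_left x

end Fock

/-! ### Conservation along evolved packets -/

section Flow

variable {J ι : Type*} [Fintype J] {μ : Measure (J → ℝ)}

/-- A time dependent function of the label which is continuous in time, measurable in the label,
and bounded on bounded sets. -/
structure IsEigenvalueFamily (lam : ℝ → (J → ℝ) → ℝ) : Prop where
  measurable : ∀ t, Measurable (lam t)
  continuous : ∀ p, Continuous fun t => lam t p
  bounded : ∀ R : ℝ, ∃ C : ℝ, ∀ t p, |t| ≤ R → ‖p‖ ≤ R → |lam t p| ≤ C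

namespace IsEigenvalueFamily

variable {lam : ℝ → (J → ℝ) → ℝ}

theorem intervalIntegrable (h : IsEigenvalueFamily lam) (p : J → ℝ) (a b : ℝ) :
    IntervalIntegrable (fun s => lam s p) volume a b := (h.continuous p).intervalIntegrable _ _

theorem measurable_integral (h : IsEigenvalueFamily lam) (t₀ t : ℝ) :
    Measurable fun p => ∫ s in t₀..t, lam s p := by
  have h1 : StronglyMeasurable fun q : (J → ℝ) × ℝ => lam q.2 q.1 :=
    ((measurable_uncurry_of_continuous_of_measurable (u := lam) h.continuous
      h.measurable).comp measurable_swap).stronglyMeasurable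
  simp only [intervalIntegral]
  exact (h1.integral_prod_right'.sub h1.integral_prod_right').measurable

/-- The amplitude `exp (-(i/ε) ∫_{t₀}^t lam) g`. -/
def evolve (h : IsEigenvalueFamily lam) (ε t₀ t : ℝ) (g : {g // IsAmplitude μ g}) :
    {g // IsAmplitude μ g} :=
  ⟨_, g.2.phase_mul (((h.measurable_integral t₀ t).const_mul (-ε⁻¹)))⟩

theorem evolve_apply (h : IsEigenvalueFamily lam) (ε t₀ t : ℝ) (g : {g // IsAmplitude μ g})
    (p : J → ℝ) : (h.evolve ε t₀ t g).1 p =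
      Complex.exp ((-ε⁻¹ * ∫ s in t₀..t, lam s p : ℝ) * Complex.I) * g.1 p := rfl

theorem hasDerivAt_evolve (h : IsEigenvalueFamily lam) (ε t₀ t : ℝ) (g : {g // IsAmplitude μ g})
    (p : J → ℝ) : HasDerivAt (fun t => (h.evolve ε t₀ t g).1 p)
      ((-ε⁻¹ : ℝ) * Complex.I * (lam t p * (h.evolve ε t₀ t g).1 p)) t := by
  have h1 : HasDerivAt (fun t => ∫ s in t₀..t, lam s p) (lam t p) t :=
    intervalIntegral.integral_hasDerivAt_right (h.intervalIntegrable p _ _)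
      (h.continuous p).stronglyMeasurable.stronglyMeasurableAtFilter (h.continuous p).continuousAt
  have h2 := ((((h1.const_mul (-ε⁻¹)).ofReal_comp).mul_const Complex.I).cexp).mul_const (g.1 p)
  refine h2.congr_deriv ?_
  rw [evolve_apply]
  push_cast
  ring

theorem norm_evolve_sub_le (h : IsEigenvalueFamily lam) (ε t₀ : ℝ) (g : {g // IsAmplitude μ g})
    {C D : ℝ} {p : J → ℝ} {s t : ℝ} (hC : ∀ r ∈ Set.uIoc t s, |lam r p| ≤ C) (hD : ‖g.1 p‖ ≤ D) :
    ‖(h.evolve ε t₀ s g).1 p - (h.evolve ε t₀ t g).1 p‖ ≤ |ε⁻¹| * C * D * |s - t| := by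
  rw [evolve_apply, evolve_apply, ← sub_mul, norm_mul]
  have e : Complex.exp ((-ε⁻¹ * ∫ r in t₀..s, lam r p : ℝ) * Complex.I) =
      Complex.exp ((-ε⁻¹ * ∫ r in t₀..t, lam r p : ℝ) * Complex.I) *
        Complex.exp (Complex.I * (-ε⁻¹ * ∫ r in t..s, lam r p : ℝ)) := by
    rw [← Complex.exp_add, ← intervalIntegral.integral_add_adjacent_intervals
      (h.intervalIntegrable p t₀ t) (h.intervalIntegrable p t s)]
    push_cast
    ring_nf
  have h1 : ‖∫ r in t..s, lam r p‖ ≤ C * |s - t| :=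
    intervalIntegral.norm_integral_le_of_norm_le_const hC
  rw [e, ← mul_sub_one, norm_mul, Complex.norm_exp_ofReal_mul_I, one_mul]
  have h2 : ‖Complex.exp (Complex.I * (-ε⁻¹ * ∫ r in t..s, lam r p : ℝ)) - 1‖ ≤
      |ε⁻¹| * (C * |s - t|) := by
    refine Real.norm_exp_I_mul_ofReal_sub_one_le.trans ?_
    rw [norm_mul, norm_neg]
    exact mul_le_mul_of_nonneg_left h1 (abs_nonneg _)
  calc _ ≤ |ε⁻¹| * (C * |s - t|) * D :=
        mul_le_mul h2 hD (norm_nonneg _) ((norm_nonneg _).trans h2)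
    _ = _ := by ring

end IsEigenvalueFamily

namespace KetFamily

variable (K : KetFamily μ ι) {lam : ℝ → (J → ℝ) → ℝ}

/-- The eigenvalues are bounded on the bounded support of `g` for times near `t`, so the amplitude
satisfies a Lipschitz bound at `t`, uniformly in the label. The automatic bound on packets turns
this into norm continuity; the estimate itself dominates the difference quotients later. -/
theorem tendsto_packet_evolve (h : IsEigenvalueFamily lam) (ε t₀ t : ℝ)
    (g : {g // IsAmplitude μ g}) :
    Tendsto (fun s => K.packet (h.evolve ε t₀ s g)) (𝓝 t) (𝓝 (K.packet (h.evolve ε t₀ t g))) ∧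
    ∃ D, ∀ᶠ s in 𝓝 t, ∀ p,
      ‖(h.evolve ε t₀ s g).1 p - (h.evolve ε t₀ t g).1 p‖ ≤ D * |s - t| := by
  obtain ⟨R, hR⟩ := g.2.bounded_support.exists_norm_le
  obtain ⟨C, hC⟩ := h.bounded (max R (|t| + 1))
  obtain ⟨B, hB⟩ := g.2.bounded
  have hD : ∀ᶠ s in 𝓝 t, ∀ p,
      ‖(h.evolve ε t₀ s g).1 p - (h.evolve ε t₀ t g).1 p‖ ≤ |ε⁻¹| * |C| * B * |s - t| := by
    filter_upwards [Metric.ball_mem_nhds t one_pos] with s hs p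
    have hB0 : 0 ≤ B := (norm_nonneg _).trans (hB p)
    by_cases hp : g.1 p = 0
    · rw [IsEigenvalueFamily.evolve_apply, IsEigenvalueFamily.evolve_apply, hp, mul_zero, mul_zero,
        sub_zero, norm_zero]
      positivity
    · refine h.norm_evolve_sub_le ε t₀ g (fun r hr => ?_) (hB p)
      refine (hC r p ?_ ((hR p hp).trans (le_max_left _ _))).trans (le_abs_self C)
      refine le_trans ?_ (le_max_right _ _)
      have h1 : |r - t| ≤ |s - t| := Set.abs_sub_left_of_mem_uIcc (Set.uIoc_subset_uIcc hr)
      have h2 : |s - t| < 1 := hs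
      have h3 := abs_sub_abs_le_abs_sub r t
      linarith
  refine ⟨?_, _, hD⟩
  obtain ⟨M, hM0, hM⟩ := K.exists_norm_packet_le (measurableSet_support g.2.measurable)
    g.2.bounded_support g.2.finite_support
  rw [tendsto_iff_norm_sub_tendsto_zero]
  refine squeeze_zero' (Eventually.of_forall fun _ => norm_nonneg _) (hD.mono fun s hs => ?_)
    (g := fun s => M * (|ε⁻¹| * |C| * B * |s - t|)) ?_
  · rw [← K.packet_sub]
    refine hM _ _ (fun p hp => ?_) hs
    have : g.1 p = 0 := Function.notMem_support.1 hp
    change (h.evolve ε t₀ s g).1 p - (h.evolve ε t₀ t g).1 p = 0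
    rw [IsEigenvalueFamily.evolve_apply, IsEigenvalueFamily.evolve_apply, this]
    simp
  · have : Tendsto (fun s => M * (|ε⁻¹| * |C| * B * |s - t|)) (𝓝 t)
        (𝓝 (M * (|ε⁻¹| * |C| * B * |t - t|))) := Continuous.tendsto (by fun_prop) t
    simpa using this

/-- The amplitude `lam t · exp (-(i/ε) ∫_{t₀}^t lam) g`. -/
def evolveMul (h : IsEigenvalueFamily lam) (ε t₀ t : ℝ) (g : {g // IsAmplitude μ g}) :
    {g // IsAmplitude μ g} :=
  ⟨fun p => (lam t p : ℂ) * (h.evolve ε t₀ t g).1 p,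
    (h.evolve ε t₀ t g).2.mul (Complex.measurable_ofReal.comp (h.measurable t)) fun R => by
      obtain ⟨C, hC⟩ := h.bounded (max R |t|)
      refine ⟨C, fun p hp => ?_⟩
      rw [Complex.norm_real]
      exact hC t p (le_max_right _ _) (hp.trans (le_max_left _ _))⟩

/-- The difference quotients of the amplitude have a common support, a common bound and a pointwise
limit, so weak dominated convergence of packets applies. -/
theorem hasDerivAt_inner_packet_evolve (h : IsEigenvalueFamily lam) (ε t₀ t : ℝ)
    (g : {g // IsAmplitude μ g}) (x : Fock ι) :
    HasDerivAt (fun s => inner ℂ x (K.packet (h.evolve ε t₀ s g)))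
      ((-ε⁻¹ : ℝ) * Complex.I * inner ℂ x (K.packet (evolveMul h ε t₀ t g))) t := by
  obtain ⟨-, D, hD⟩ := K.tendsto_packet_evolve h ε t₀ t g
  rw [hasDerivAt_iff_tendsto_slope, ← Fock.inner_smul_right, ← packet_const_mul]
  have e : ∀ s, slope (fun s => inner ℂ x (K.packet (h.evolve ε t₀ s g))) t s = inner ℂ x (K.packet
      ⟨_, ((h.evolve ε t₀ s g).2.sub (h.evolve ε t₀ t g).2).const_mul (((s - t)⁻¹ : ℝ) : ℂ)⟩) := by
    intro s
    rw [K.packet_const_mul _ ⟨_, (h.evolve ε t₀ s g).2.sub (h.evolve ε t₀ t g).2⟩, packet_sub,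
      Fock.inner_smul_right, Fock.inner_sub_right, slope_def_module, Complex.real_smul]
  refine Tendsto.congr (fun s => (e s).symm) (K.tendsto_inner_packet (measurableSet_support g.2.measurable)
    g.2.bounded_support g.2.finite_support (D := |D|) (fun s p hp => ?_) ?_ (fun p => ?_) x)
  · have : g.1 p = 0 := Function.notMem_support.1 hp
    simp [IsEigenvalueFamily.evolve_apply, this]
  · filter_upwards [hD.filter_mono nhdsWithin_le_nhds, self_mem_nhdsWithin] with s hs hst p
    have h0 : 0 < |s - t| := abs_pos.2 (sub_ne_zero.2 hst)
    rw [norm_mul, Complex.norm_real, norm_inv, Real.norm_eq_abs, inv_mul_le_iff₀ h0, mul_comm]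
    exact (hs p).trans (mul_le_mul_of_nonneg_right (le_abs_self D) h0.le)
  · have h1 := h.hasDerivAt_evolve ε t₀ t g p
    rw [hasDerivAt_iff_tendsto_slope] at h1
    refine h1.congr fun s => ?_
    rw [slope_def_module, Complex.real_smul]

/-- Along a solution `u` of `i ε u' = T u`, the component of `u` along the evolved wave packet
is constant. -/
theorem inner_packet_evolve_eq (h : IsEigenvalueFamily lam) {ε : ℝ} (hε : ε ≠ 0)
    {T : ℝ → Submodule ℂ (Fock ι × Fock ι)}
    (hT : ∀ t, K.IsGeneralizedEigenfamily (T t) (lam t)) {u v : ℝ → Fock ι}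
    (hu : ∀ s, HasDerivAt u (v s) s) (hv : ∀ s, (u s, (Complex.I * ε) • v s) ∈ T s)
    (t₀ t : ℝ) (g : {g // IsAmplitude μ g}) :
    inner ℂ (u t) (K.packet (h.evolve ε t₀ t g)) = inner ℂ (u t₀) (K.packet g) := by
  have hd : ∀ t, HasDerivAt (fun s => inner ℂ (u s) (K.packet (h.evolve ε t₀ s g))) 0 t := by
    intro t
    have h1 := K.hasDerivAt_inner_packet_evolve h ε t₀ t g (u t)
    -- The packet is known to be differentiable only weakly, so the product rule is split: the term
    -- with u s - u t uses the strong derivative of `u` and the norm continuity of the packet, the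
    -- term with u t the weak derivative `h1`.
    have h2 : HasDerivAt (fun s => inner ℂ (u s - u t) (K.packet (h.evolve ε t₀ s g)))
        (inner ℂ (v t) (K.packet (h.evolve ε t₀ t g))) t := by
      rw [hasDerivAt_iff_tendsto_slope]
      have h3 := (hasDerivAt_iff_tendsto_slope.1 (hu t)).inner (𝕜 := ℂ)
        ((K.tendsto_packet_evolve h ε t₀ t g).1.mono_left nhdsWithin_le_nhds)
      refine h3.congr fun s => ?_
      rw [slope_def_module, slope_def_module, sub_self, Fock.inner_zero_left, sub_zero,
        Fock.inner_smul_left_real, Complex.real_smul]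
    -- The factor `I * ε` leaves the antilinear slot as `-I * ε`; multiplied by `-ε⁻¹ * I` it gives
    -- `I ^ 2`, and the two terms cancel.
    have h4 := (h2.add h1).congr_deriv (g' := 0) (by
      have h5 := hT t _ (hv t) (h.evolve ε t₀ t g) (evolveMul h ε t₀ t g) fun p => rfl
      rw [show (u t, (Complex.I * ε) • v t).2 = (Complex.I * ε) • v t from rfl,
        Fock.inner_smul_left] at h5
      rw [← h5]
      have hε' : (ε : ℂ) ≠ 0 := by exact_mod_cast hε
      simp only [map_mul, Complex.conj_I, Complex.conj_ofReal]
      push_cast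
      have : ∀ z : ℂ, z + -(ε : ℂ)⁻¹ * Complex.I * (-Complex.I * ε * z) = z + Complex.I ^ 2 * z := by
        intro z; field_simp
      rw [this, Complex.I_sq]
      ring)
    refine h4.congr_of_eventuallyEq (Eventually.of_forall fun s => ?_)
    simp only [Pi.add_apply]
    rw [← Fock.inner_add_left, sub_add_cancel]
  have h6 := is_const_of_deriv_eq_zero (fun t => (hd t).differentiableAt) (fun t => (hd t).deriv) t t₀
  refine h6.trans ?_
  congr 2
  refine Subtype.ext (funext fun p => ?_)
  rw [IsEigenvalueFamily.evolve_apply]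
  simp

/-- The unitary evolution multiplies the generalized eigenvectors by phases. -/
theorem propagator_packet (h : IsEigenvalueFamily lam) {ε : ℝ} (hε : ε ≠ 0)
    {G : ℝ → Submodule ℂ (Fock ι × Fock ι)} {t₀ : ℝ} {U : ℝ → Fock ι ≃ₗᵢ[ℂ] Fock ι}
    (hU : IsPropagator G t₀ U)
    (hT : ∀ t, K.IsGeneralizedEigenfamily (smulGraph ε (G t)) (lam t)) (t : ℝ)
    (g : {g // IsAmplitude μ g}) : U t (K.packet g) = K.packet (h.evolve ε t₀ t g) := by
  obtain ⟨h0, Y, hY, hd⟩ := hU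
  rw [← (U t).apply_symm_apply (K.packet (h.evolve ε t₀ t g))]
  congr 1
  -- By unitarity, pairing `y` with the preimage of the evolved packet is pairing `U t y` with the
  -- evolved packet, and this is conserved.
  refine hY.eq_of_inner_right ℂ fun y hy => ?_
  choose v hv hG using hd y hy
  have h1 := K.inner_packet_evolve_eq h hε hT hv (fun s => ?_) t₀ t g
  · rw [h0 y] at h1
    rw [← h1, ← (U t).inner_map_map y, (U t).apply_symm_apply]
  · refine ⟨_, hG s, ?_⟩
    simp [mul_smul]

end KetFamily

end Flow

/-! ### Second quantized characters of `P` acting on packets -/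

section Translation

variable {J ι H : Type*} [Fintype J] [NormedAddCommGroup H] [InnerProductSpace ℂ H]
  [CompleteSpace H] (b : HilbertBasis ι ℂ H) {μ : Measure (J → ℝ)}

/-- The amplitude `exp (i θ) g`. -/
def phaseAmplitude {θ : (J → ℝ) → ℝ} (hθ : Measurable θ) (g : {g // IsAmplitude μ g}) :
    {g // IsAmplitude μ g} := ⟨_, g.2.phase_mul hθ⟩

theorem phaseAmplitude_apply {θ : (J → ℝ) → ℝ} (hθ : Measurable θ) (g : {g // IsAmplitude μ g})
    (p : J → ℝ) : (phaseAmplitude hθ g).1 p = Complex.exp (θ p * Complex.I) * g.1 p := rfl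

theorem isEigenvalueFamily_coord (j : J) : IsEigenvalueFamily fun _ (p : J → ℝ) => p j where
  measurable _ := measurable_pi_apply j
  continuous _ := continuous_const
  bounded R := ⟨R, fun _ p _ hp => (norm_le_pi_norm p j).trans hp⟩

theorem tensor_singleton_smul (c : ℂ) (f : H) : tensor b [c • f] = c • tensor b [f] := by
  rw [tensor_cons, tensor_cons, map_smul]
  rfl

theorem symmetrize_tmul_smul (n : ℕ) (x y : FullFock ι) (c : ℂ) :
    symmetrize (tmul n x (c • y)) = c • symmetrize (tmul n x y) := by
  have : tmul n x (c • y) = c • tmul n x y := by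
    refine lp.ext (funext fun l => ?_)
    change x _ * (c * y _) = c * (x _ * y _)
    ring
  rw [this, symmetrize, symmetrize, map_smul]

theorem continuous_tensor_replicate (n : ℕ) :
    Continuous fun φ : H => tensor b (List.replicate n φ) := by
  induction n with
  | zero => exact (continuous_const : Continuous fun _ : H => tensor b [])
  | succ n ih =>
    simp only [List.replicate_succ, tensor_cons]
    exact (creation b).continuous.clm_apply ih

variable (E : ProjectionValuedMeasure (J → ℝ) H) (K : KetFamily μ ι) (ε : ℝ)

/-- The second quantization of `exp (i u(P))` multiplies `|p⟩` by `exp (i u(p) / ε)`; tested on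
tensor powers. -/
def ActsAsPhase {u : (J → ℝ) → ℝ} (hu : Measurable u) : Prop :=
  ∀ (n : ℕ) (φ : H) (g : {g // IsAmplitude μ g}),
    inner ℂ (tensor b (List.replicate n (E.phase hu φ))) (K.packet g : FullFock ι) =
      inner ℂ (tensor b (List.replicate n φ))
        (K.packet (phaseAmplitude (hu.const_mul (-ε⁻¹)) g) : FullFock ι)

variable {b E K ε}

theorem ActsAsPhase.congr {u v : (J → ℝ) → ℝ} {hu : Measurable u} (h : ActsAsPhase b E K ε hu)
    (huv : u = v) (hv : Measurable v) : ActsAsPhase b E K ε hv := by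
  subst huv
  exact h

theorem ActsAsPhase.add {u v : (J → ℝ) → ℝ} {hu : Measurable u} {hv : Measurable v}
    (h : ActsAsPhase b E K ε hu) (h' : ActsAsPhase b E K ε hv) :
    ActsAsPhase b E K ε (hu.add hv) := by
  intro n φ g
  rw [← E.phase_phase hu hv, h, h']
  congr 3
  refine Subtype.ext (funext fun p => ?_)
  simp only [phaseAmplitude_apply, Pi.add_apply]
  rw [← mul_assoc, ← Complex.exp_add]
  push_cast
  ring_nf

theorem ActsAsPhase.zero : ActsAsPhase b E K ε (measurable_const (a := (0 : ℝ))) := by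
  intro n φ g
  have h1 : E.phase (measurable_const (a := (0 : ℝ))) φ = φ := by
    rw [E.phase_apply]
    simp [E.integral_one]
  rw [h1]
  congr 3
  refine Subtype.ext (funext fun p => ?_)
  simp [phaseAmplitude_apply]

open IsJointSpectralMeasure in
theorem ActsAsPhase.coord {P : J → H →ₗ.[ℂ] H} (hE : IsJointSpectralMeasure P E) (hε : ε ≠ 0)
    {j : J} (hP : K.IsGeneralizedEigenfamily (smulGraph ε (secondQuantization b (P j)))
      fun p => p j) (s : ℝ) : ActsAsPhase b E K ε (measurable_smul_coord j s) := by
  intro n φ g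
  have hc : ∀ {y : H → FullFock ι} (z : FullFock ι), Continuous y →
      Continuous fun φ => inner ℂ (y φ) z := fun z hy => hy.inner continuous_const
  -- Both sides are continuous in `φ`, so the spectral support of `φ` may be taken bounded in the
  -- direction `j`; then the orbit is differentiable.
  refine congrFun (Continuous.ext_on (dense_slab E j)
    (hc _ ((continuous_tensor_replicate b n).comp (E.phase (measurable_smul_coord j s)).continuous))
    (hc _ (continuous_tensor_replicate b n)) fun φ hφ => ?_) φ
  obtain ⟨N, hN⟩ := hφ
  have hd : ∀ r : ℝ, HasDerivAt (fun r => E.phase (measurable_smul_coord j (-r)) φ)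
      ((-Complex.I) • P j ⟨E.phase (measurable_smul_coord j (-r)) φ,
        hE.mem_domain (proj_phase E hN (measurable_smul_coord j (-r)))⟩) r := fun r => by
    have h1 := (hE.hasDerivAt_phase hN (-r)).scomp r (hasDerivAt_neg r)
    refine h1.congr_deriv ?_
    rw [neg_one_smul, neg_smul]
  have hu := fun r => hasDerivAt_tensorPow b (hd r) n
  -- The curve u(r) = (exp(-irP_j)φ)^{⊗n} solves iεu' = Tu, where T is ε times the second
  -- quantization of P_j. At time -s it is (exp(isP_j)φ)^{⊗n}, and the initial amplitude is chosen
  -- so that the evolved one is `g`.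
  have key := K.inner_packet_evolve_eq (isEigenvalueFamily_coord j) hε (fun _ => hP) hu
    (fun r => by
      rw [tensor_singleton_smul, symmetrize_tmul_smul]
      refine ⟨_, Submodule.le_topologicalClosure _ (Submodule.subset_span ⟨n,
        ⟨E.phase (measurable_smul_coord j (-r)) φ,
          hE.mem_domain (proj_phase E hN (measurable_smul_coord j (-r)))⟩, rfl⟩), ?_⟩
      refine Prod.ext rfl ?_
      simp only [LinearMap.prodMap_apply, LinearMap.smul_apply, LinearMap.id_apply, smul_smul]
      congr 1
      have : Complex.I * ε * (n * -Complex.I) = -(Complex.I ^ 2) * ε * n := by ring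
      rw [this, Complex.I_sq]
      ring) 0 (-s) (phaseAmplitude ((measurable_smul_coord j s).const_mul (-ε⁻¹)) g)
  have e1 : (isEigenvalueFamily_coord j).evolve ε 0 (-s)
      (phaseAmplitude ((measurable_smul_coord j s).const_mul (-ε⁻¹)) g) = g := by
    refine Subtype.ext (funext fun p => ?_)
    rw [IsEigenvalueFamily.evolve_apply, phaseAmplitude_apply, ← mul_assoc, ← Complex.exp_add]
    simp
  rw [e1] at key
  have e2 : E.phase (measurable_smul_coord j (-0)) φ = φ := by
    rw [E.phase_apply]
    simp [E.integral_one]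
  rw [e2] at key
  have e3 : E.phase (measurable_smul_coord j (- -s)) φ = E.phase (measurable_smul_coord j s) φ := by
    simp only [E.phase_apply, neg_neg]
  rw [e3] at key
  exact key

theorem measurable_dot (a : J → ℝ) : Measurable fun k : J → ℝ => ∑ j, a j * k j := by fun_prop

theorem actsAsPhase_dot {P : J → H →ₗ.[ℂ] H} (hE : IsJointSpectralMeasure P E) (hε : ε ≠ 0)
    (hP : ∀ j, K.IsGeneralizedEigenfamily (smulGraph ε (secondQuantization b (P j)))
      fun p => p j) (a : J → ℝ) : ActsAsPhase b E K ε (measurable_dot a) := by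
  classical
  suffices ∀ (s : Finset J) (hs : Measurable fun k : J → ℝ => ∑ j ∈ s, a j * k j),
      ActsAsPhase b E K ε hs from this _ _
  intro s
  induction s using Finset.induction_on with
  | empty => exact fun hs => ActsAsPhase.zero.congr (by simp) hs
  | insert j s hj ih =>
    intro hs
    refine ((ActsAsPhase.coord hE hε (hP j) (a j)).add (ih (by fun_prop))).congr ?_ hs
    funext k
    rw [Finset.sum_insert hj]
    rfl

/-- Packets are symmetric, so testing on tensor powers is enough. -/
theorem ActsAsPhase.isTensorPullback {u : (J → ℝ) → ℝ} {hu : Measurable u}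
    (h : ActsAsPhase b E K ε hu) (g : {g // IsAmplitude μ g}) :
    IsTensorPullback b (E.phase hu) (K.packet g : FullFock ι)
      (K.packet (phaseAmplitude (hu.const_mul (-ε⁻¹)) g) : FullFock ι) :=
  isTensorPullback_of_replicate b ((E.phase hu).toLinearEquiv : H →ₗ[ℂ] H) (K.packet g).2
    (K.packet _).2 fun n φ => h n φ g

end Translation

/-! ### Uniqueness and transformation of kernels -/

section Kernels

variable {J ι : Type*} [Fintype J] {μ : Measure (J → ℝ)}

/-- An exhaustion of the label space by bounded sets of finite measure. -/
def exhaustion (μ : Measure (J → ℝ)) [SigmaFinite μ] (n : ℕ) : Set (J → ℝ) :=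
  spanningSets μ n ∩ Metric.closedBall 0 n

theorem measurableSet_exhaustion [SigmaFinite μ] (n : ℕ) : MeasurableSet (exhaustion μ n) :=
  (measurableSet_spanningSets μ n).inter measurableSet_closedBall

theorem iUnion_exhaustion_prod (μ : Measure (J → ℝ)) [SigmaFinite μ] :
    ⋃ n, exhaustion μ n ×ˢ exhaustion μ n = Set.univ := by
  refine Set.eq_univ_of_forall fun q => ?_
  have h : ∀ p, ∃ N, ∀ n ≥ N, p ∈ exhaustion μ n := by
    intro p
    have h1 : p ∈ ⋃ n, spanningSets μ n := by rw [iUnion_spanningSets]; trivial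
    obtain ⟨N, hN⟩ := Set.mem_iUnion.1 h1
    obtain ⟨N', hN'⟩ := exists_nat_ge ‖p‖
    refine ⟨max N N', fun n hn => ⟨monotone_spanningSets μ ((le_max_left _ _).trans hn) hN, ?_⟩⟩
    rw [mem_closedBall_zero_iff]
    exact hN'.trans (by exact_mod_cast (le_max_right _ _).trans hn)
  obtain ⟨N, hN⟩ := h q.1
  obtain ⟨N', hN'⟩ := h q.2
  exact Set.mem_iUnion.2 ⟨max N N', hN _ (le_max_left _ _), hN' _ (le_max_right _ _)⟩

theorem isAmplitude_indicator_exhaustion [SigmaFinite μ] (n : ℕ) {A : Set (J → ℝ)}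
    (hA : MeasurableSet A) : IsAmplitude μ ((A ∩ exhaustion μ n).indicator fun _ => 1) := by
  refine IsAmplitude.indicator_one (hA.inter (measurableSet_exhaustion n)) ?_ ?_
  · exact Metric.isBounded_closedBall.subset (Set.inter_subset_right.trans Set.inter_subset_right)
  · exact (measure_mono (Set.inter_subset_right.trans Set.inter_subset_left)).trans_lt
      (measure_spanningSets_lt_top μ n)

/-- A kernel is determined almost everywhere by its form on amplitudes. -/
theorem ae_eq_zero_of_forall_integral_amplitude [SigmaFinite μ] {D : (J → ℝ) × (J → ℝ) → ℂ}
    (hD : ∀ g g' : {g // IsAmplitude μ g},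
      Integrable (fun q => starRingEnd ℂ (g.1 q.1) * D q * g'.1 q.2) (μ.prod μ) ∧
      ∫ q, starRingEnd ℂ (g.1 q.1) * D q * g'.1 q.2 ∂(μ.prod μ) = 0) :
    D =ᵐ[μ.prod μ] 0 := by
  -- Indicator amplitudes test `D` on the rectangles inside a square of the exhaustion, and also
  -- show that `D` is integrable there.
  have key : ∀ n, ∀ A B : Set (J → ℝ), MeasurableSet A → MeasurableSet B →
      IntegrableOn D ((A ∩ exhaustion μ n) ×ˢ (B ∩ exhaustion μ n)) (μ.prod μ) ∧
      ∫ q in (A ∩ exhaustion μ n) ×ˢ (B ∩ exhaustion μ n), D q ∂(μ.prod μ) = 0 := by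
    intro n A B hA hB
    have hm : MeasurableSet ((A ∩ exhaustion μ n) ×ˢ (B ∩ exhaustion μ n)) :=
      (hA.inter (measurableSet_exhaustion n)).prod (hB.inter (measurableSet_exhaustion n))
    have h := hD ⟨_, isAmplitude_indicator_exhaustion n hA⟩
      ⟨_, isAmplitude_indicator_exhaustion n hB⟩
    have e : (fun q : (J → ℝ) × (J → ℝ) =>
        starRingEnd ℂ ((A ∩ exhaustion μ n).indicator (fun _ => (1 : ℂ)) q.1) * D q *
          (B ∩ exhaustion μ n).indicator (fun _ => (1 : ℂ)) q.2) =
        ((A ∩ exhaustion μ n) ×ˢ (B ∩ exhaustion μ n)).indicator D := by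
      funext q
      by_cases h1 : q.1 ∈ A ∩ exhaustion μ n
      · by_cases h2 : q.2 ∈ B ∩ exhaustion μ n
        · rw [Set.indicator_of_mem h1, Set.indicator_of_mem h2,
            Set.indicator_of_mem (Set.mk_mem_prod h1 h2)]
          simp
        · rw [Set.indicator_of_notMem h2, mul_zero]
          exact (Set.indicator_of_notMem (fun h => h2 h.2) D).symm
      · rw [Set.indicator_of_notMem h1, map_zero, zero_mul, zero_mul]
        exact (Set.indicator_of_notMem (fun h => h1 h.1) D).symm
    rw [e, integrable_indicator_iff hm, integral_indicator hm] at h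
    exact h
  have hn : ∀ n, D =ᵐ[(μ.prod μ).restrict (exhaustion μ n ×ˢ exhaustion μ n)] 0 := by
    intro n
    have hu := key n Set.univ Set.univ .univ .univ
    rw [Set.univ_inter] at hu
    -- Rectangles form a generating π-system; integrability on the square handles complements and
    -- countable disjoint unions.
    suffices ∀ s, MeasurableSet s → ∫ q in s, D q
        ∂((μ.prod μ).restrict (exhaustion μ n ×ˢ exhaustion μ n)) = 0 from
      Integrable.ae_eq_zero_of_forall_setIntegral_eq_zero hu.1 fun s hs _ => this s hs
    intro s hs
    induction s, hs using MeasurableSpace.induction_on_inter generateFrom_prod.symm isPiSystem_prod with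
    | empty => simp
    | basic t ht =>
      obtain ⟨A, hA, B, hB, rfl⟩ := ht
      rw [Measure.restrict_restrict (MeasurableSet.prod (show MeasurableSet A from hA)
        (show MeasurableSet B from hB)), Set.prod_inter_prod]
      exact (key n A B hA hB).2
    | compl t ht ih =>
      have := integral_add_compl ht hu.1
      rwa [ih, zero_add, hu.2] at this
    | iUnion f hd hf ih =>
      have := hasSum_integral_iUnion hf hd (Integrable.integrableOn hu.1)
      simp only [ih] at this
      exact this.unique hasSum_zero
  have h := (ae_restrict_iUnion_iff (μ := μ.prod μ) (fun n => exhaustion μ n ×ˢ exhaustion μ n)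
    (fun q => D q = 0)).2 hn
  rw [iUnion_exhaustion_prod, Measure.restrict_univ] at h
  exact h

theorem ae_eq_of_forall_integral_amplitude [SigmaFinite μ] {M N : (J → ℝ) × (J → ℝ) → ℂ}
    (h : ∀ g g' : {g // IsAmplitude μ g},
      Integrable (fun q => starRingEnd ℂ (g.1 q.1) * M q * g'.1 q.2) (μ.prod μ) ∧
      Integrable (fun q => starRingEnd ℂ (g.1 q.1) * N q * g'.1 q.2) (μ.prod μ) ∧
      ∫ q, starRingEnd ℂ (g.1 q.1) * M q * g'.1 q.2 ∂(μ.prod μ) =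
        ∫ q, starRingEnd ℂ (g.1 q.1) * N q * g'.1 q.2 ∂(μ.prod μ)) :
    M =ᵐ[μ.prod μ] N := by
  have h1 := ae_eq_zero_of_forall_integral_amplitude (μ := μ) (D := fun q => M q - N q)
    fun g g' => by
      obtain ⟨hM, hN, he⟩ := h g g'
      simp only [mul_sub, sub_mul]
      exact ⟨hM.sub hN, by rw [integral_sub hM hN, he, sub_self]⟩
  exact h1.mono fun q hq => sub_eq_zero.1 hq

/-- The kernel `conj (exp (i θ(p))) M(p, p') exp (i θ(p'))`. -/
def phaseKernel (θ : (J → ℝ) → ℝ) (M : (J → ℝ) → (J → ℝ) → ℂ) (p p' : J → ℝ) : ℂ :=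
  Complex.exp ((θ p' - θ p : ℝ) * Complex.I) * M p p'

theorem aestronglyMeasurable_phaseKernel {θ : (J → ℝ) → ℝ} (hθ : Measurable θ)
    {M : (J → ℝ) → (J → ℝ) → ℂ}
    (hM : AEStronglyMeasurable (Function.uncurry M) (μ.prod μ)) :
    AEStronglyMeasurable (Function.uncurry (phaseKernel θ M)) (μ.prod μ) := by
  have h1 : Measurable fun q : (J → ℝ) × (J → ℝ) =>
      Complex.exp ((θ q.2 - θ q.1 : ℝ) * Complex.I) := by fun_prop
  exact h1.aestronglyMeasurable.mul hM

theorem _root_.MeasureTheory.Integrable.phaseKernel {θ : (J → ℝ) → ℝ} (hθ : Measurable θ)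
    {M : (J → ℝ) → (J → ℝ) → ℂ} {p : J → ℝ} (hM : Integrable (M p) μ) :
    Integrable (phaseKernel θ M p) μ := by
  have h1 : Measurable fun p' => Complex.exp ((θ p' - θ p : ℝ) * Complex.I) := by fun_prop
  exact hM.bdd_mul h1.aestronglyMeasurable
    (Eventually.of_forall fun p' => (Complex.norm_exp_ofReal_mul_I _).le)

/-- The phase factorizes, so it can be moved onto the amplitudes: the form of the phased kernel is
the form of `M` on phased packets. -/
theorem conj_mul_phaseKernel_mul (θ : (J → ℝ) → ℝ) (M : (J → ℝ) → (J → ℝ) → ℂ) (z w : ℂ)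
    (p p' : J → ℝ) : starRingEnd ℂ z * phaseKernel θ M p p' * w =
      starRingEnd ℂ (Complex.exp (θ p * Complex.I) * z) * M p p' *
        (Complex.exp (θ p' * Complex.I) * w) := by
  have h1 : Complex.exp ((θ p' - θ p : ℝ) * Complex.I) =
      starRingEnd ℂ (Complex.exp (θ p * Complex.I)) * Complex.exp (θ p' * Complex.I) := by
    rw [← Complex.exp_conj, ← Complex.exp_add]
    simp only [map_mul, Complex.conj_ofReal, Complex.conj_I]
    push_cast
    ring_nf
  rw [phaseKernel, h1, map_mul]
  ring

namespace KetFamily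

variable {K : KetFamily μ ι}

theorem IsMatrixElement.phase {A : Fock ι → Fock ι → Prop} {M : (J → ℝ) → (J → ℝ) → ℂ}
    (hM : K.IsMatrixElement A M) {θ : (J → ℝ) → ℝ} (hθ : Measurable θ)
    (g g' : {g // IsAmplitude μ g}) : ∃ y, A (K.packet (phaseAmplitude hθ g')) y ∧
      Integrable (fun q : (J → ℝ) × (J → ℝ) =>
        starRingEnd ℂ (g.1 q.1) * phaseKernel θ M q.1 q.2 * g'.1 q.2) (μ.prod μ) ∧
      inner ℂ (K.packet (phaseAmplitude hθ g)) y =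
        ∫ q, starRingEnd ℂ (g.1 q.1) * phaseKernel θ M q.1 q.2 * g'.1 q.2 ∂(μ.prod μ) := by
  obtain ⟨y, hy, hi, he⟩ := hM.2 (phaseAmplitude hθ g) (phaseAmplitude hθ g')
  refine ⟨y, hy, ?_⟩
  simp only [conj_mul_phaseKernel_mul]
  exact ⟨hi, he⟩

/-- Matrix elements of the operators of annihilation in the Heisenberg picture. -/
theorem IsMatrixElement.heisenberg {H : Type*} [NormedAddCommGroup H] [InnerProductSpace ℂ H]
    {b : HilbertBasis ι ℂ H} {U : Fock ι ≃ₗᵢ[ℂ] Fock ι} {θ : (J → ℝ) → ℝ} (hθ : Measurable θ)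
    (hU : ∀ g, U (K.packet g) = K.packet (phaseAmplitude hθ g)) {f : H}
    {M : (J → ℝ) → (J → ℝ) → ℂ} (hM : K.IsMatrixElement (IsAnnihilation b f) M) :
    K.IsMatrixElement (IsHeisenbergAnnihilation b U f) (phaseKernel θ M) := by
  refine ⟨aestronglyMeasurable_phaseKernel hθ hM.1, fun g g' => ?_⟩
  obtain ⟨y, hy, hi, he⟩ := hM.phase hθ g g'
  refine ⟨U.symm y, ?_, hi, ?_⟩
  · rw [IsHeisenbergAnnihilation, hU, U.apply_symm_apply]
    exact hy
  · rw [← he, ← hU]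
    exact (U.inner_map_map _ _).symm.trans (by rw [U.apply_symm_apply])

theorem IsMatrixElement.ae_eq [SigmaFinite μ] {A : Fock ι → Fock ι → Prop}
    (hA : ∀ x y y', A x y → A x y' → y = y') {M N : (J → ℝ) → (J → ℝ) → ℂ}
    (hM : K.IsMatrixElement A M) (hN : K.IsMatrixElement A N) :
    Function.uncurry M =ᵐ[μ.prod μ] Function.uncurry N :=
  ae_eq_of_forall_integral_amplitude fun g g' => by
    obtain ⟨y, hy, hi, he⟩ := hM.2 g g'
    obtain ⟨y', hy', hi', he'⟩ := hN.2 g g'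
    rw [hA _ _ _ hy' hy] at he'
    exact ⟨hi, hi', he.symm.trans he'⟩

theorem _root_.IsAnnihilation.unique {H : Type*} [NormedAddCommGroup H] [InnerProductSpace ℂ H]
    {b : HilbertBasis ι ℂ H} {f : H} {x y y' : Fock ι} (h : IsAnnihilation b f x y)
    (h' : IsAnnihilation b f x y') : y = y' :=
  Subtype.ext (lp.ext (funext fun l => (h l).trans (h' l).symm))

/-- Matrix elements of `a(exp (i u(P)) f)`. -/
theorem IsMatrixElement.ae_eq_phaseKernel [SigmaFinite μ] {H : Type*} [NormedAddCommGroup H]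
    [InnerProductSpace ℂ H] [CompleteSpace H] {b : HilbertBasis ι ℂ H}
    {E : ProjectionValuedMeasure (J → ℝ) H} {ε : ℝ} {u : (J → ℝ) → ℝ} {hu : Measurable u}
    (h : ActsAsPhase b E K ε hu) {f : H} {M N : (J → ℝ) → (J → ℝ) → ℂ}
    (hM : K.IsMatrixElement (IsAnnihilation b f) M)
    (hN : K.IsMatrixElement (IsAnnihilation b (E.phase hu f)) N) :
    Function.uncurry N =ᵐ[μ.prod μ] Function.uncurry (phaseKernel (fun p => -ε⁻¹ * u p) M) :=
  ae_eq_of_forall_integral_amplitude fun g g' => by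
    obtain ⟨y, hy, hi, he⟩ := hN.2 g g'
    obtain ⟨y', hy', hi', he'⟩ := hM.phase (hu.const_mul (-ε⁻¹)) g g'
    refine ⟨hi, hi', ?_⟩
    refine he.symm.trans (Eq.trans ?_ he')
    -- Γ(V)⁻¹, with V = exp(iu(P)), carries the first packet to its phased version and a(Vf) of the
    -- second to a(f) of its phased version; the inner product is preserved.
    exact (h.isTensorPullback g).inner_eq b ((h.isTensorPullback g').annihilation b hy hy')

end KetFamily

end Kernels

/-! ### Complex measures and their characteristic functions -/

section CharacteristicFunctions

variable {J : Type*} [Fintype J]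

/-- The function `k ↦ exp (-i a · k)`. -/
def dotPhase (a k : J → ℝ) : ℂ := Complex.exp ((-∑ j, a j * k j : ℝ) * Complex.I)

theorem measurable_dotPhase (a : J → ℝ) : Measurable (dotPhase a) := by
  unfold dotPhase; fun_prop

theorem norm_dotPhase (a k : J → ℝ) : ‖dotPhase a k‖ = 1 := Complex.norm_exp_ofReal_mul_I _

theorem isBoundedMeasurable_dotPhase (a : J → ℝ) : IsBoundedMeasurable (dotPhase a) :=
  ⟨measurable_dotPhase a, 1, fun k => (norm_dotPhase a k).le⟩

theorem continuous_integral_dotPhase (ν : Measure (J → ℝ)) [IsFiniteMeasure ν] :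
    Continuous fun a => ∫ k, dotPhase a k ∂ν :=
  continuous_of_dominated (bound := fun _ => 1)
    (fun a => (measurable_dotPhase a).aestronglyMeasurable)
    (fun a => Eventually.of_forall fun k => (norm_dotPhase a k).le) (integrable_const _)
    (Eventually.of_forall fun k => by unfold dotPhase; fun_prop)

theorem conj_integral_dotPhase (ν : Measure (J → ℝ)) (a : J → ℝ) :
    starRingEnd ℂ (∫ k, dotPhase a k ∂ν) = ∫ k, dotPhase (-a) k ∂ν := by
  rw [← integral_conj]
  congr 1
  funext k
  rw [dotPhase, dotPhase, ← Complex.exp_conj]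
  simp

/-- Every linear functional on `J → ℝ` is a dot product, so these integrals are all the values of
the characteristic function on the dual. -/
theorem measure_ext_of_integral_dotPhase {ν ν' : Measure (J → ℝ)} [IsFiniteMeasure ν]
    [IsFiniteMeasure ν'] (h : ∀ a, ∫ k, dotPhase a k ∂ν = ∫ k, dotPhase a k ∂ν') : ν = ν' := by
  classical
  refine Measure.ext_of_charFunDual (funext fun L => ?_)
  have e : ∀ k, Complex.exp (L k * Complex.I) =
      dotPhase (fun j => -L fun i => if j = i then 1 else 0) k := by
    intro k
    have := LinearMap.pi_apply_eq_sum_univ (L : (J → ℝ) →ₗ[ℝ] ℝ) k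
    rw [ContinuousLinearMap.coe_coe] at this
    rw [this, dotPhase, ← Finset.sum_neg_distrib]
    congr 3
    refine Finset.sum_congr rfl fun j _ => ?_
    simp [mul_comm]
  rw [charFunDual_apply, charFunDual_apply]
  simp only [e]
  exact h _

/-- The integral of `m` with respect to the complex measure `ν₀ - ν₂ + i (ν₁ - ν₃)`. -/
def complexIntegral (ν : Fin 4 → Measure (J → ℝ)) (m : (J → ℝ) → ℂ) : ℂ :=
  (∫ k, m k ∂(ν 0) - ∫ k, m k ∂(ν 2)) + Complex.I * (∫ k, m k ∂(ν 1) - ∫ k, m k ∂(ν 3))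

/-- A complex measure is determined by its characteristic function, on a dense set. -/
theorem complexIntegral_eq_of_dense {ν ν' : Fin 4 → Measure (J → ℝ)}
    [∀ i, IsFiniteMeasure (ν i)] [∀ i, IsFiniteMeasure (ν' i)] {S : Set (J → ℝ)} (hS : Dense S)
    (h : ∀ a ∈ S, complexIntegral ν (dotPhase a) = complexIntegral ν' (dotPhase a))
    {m : (J → ℝ) → ℂ} (hm : IsBoundedMeasurable m) :
    complexIntegral ν m = complexIntegral ν' m := by
  have hc : ∀ (ν : Fin 4 → Measure (J → ℝ)) [∀ i, IsFiniteMeasure (ν i)],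
      Continuous fun a => complexIntegral ν (dotPhase a) := fun ν _ =>
    ((continuous_integral_dotPhase _).sub (continuous_integral_dotPhase _)).add
      (continuous_const.mul
        ((continuous_integral_dotPhase _).sub (continuous_integral_dotPhase _)))
  have h1 := fun a => congrFun (Continuous.ext_on hS (hc ν) (hc ν') h) a
  -- Conjugation at `-a` reverses the sign of the imaginary part of the complex measure only; half
  -- sums and half differences separate the real and imaginary parts.
  have h2 : ∀ a, _ := fun a => congrArg (starRingEnd ℂ) (h1 (-a))
  simp only [complexIntegral, map_add, map_sub, map_mul, Complex.conj_I, conj_integral_dotPhase,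
    neg_neg] at h1 h2
  have hadd : ∀ (ρ ρ' : Measure (J → ℝ)) [IsFiniteMeasure ρ] [IsFiniteMeasure ρ']
      {m : (J → ℝ) → ℂ}, IsBoundedMeasurable m →
      ∫ k, m k ∂(ρ + ρ') = ∫ k, m k ∂ρ + ∫ k, m k ∂ρ' := fun ρ ρ' _ _ m hm =>
    integral_add_measure (hm.integrable _) (hm.integrable _)
  -- Moving the negative parts to the other side leaves an identity of finite positive measures, to
  -- which uniqueness applies.
  have e1 : ν 0 + ν' 2 = ν' 0 + ν 2 := measure_ext_of_integral_dotPhase fun a => by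
    rw [hadd _ _ (isBoundedMeasurable_dotPhase a), hadd _ _ (isBoundedMeasurable_dotPhase a)]
    linear_combination (1 / 2 : ℂ) * (h1 a) + (1 / 2 : ℂ) * (h2 a)
  have e2 : ν 1 + ν' 3 = ν' 1 + ν 3 := measure_ext_of_integral_dotPhase fun a => by
    rw [hadd _ _ (isBoundedMeasurable_dotPhase a), hadd _ _ (isBoundedMeasurable_dotPhase a)]
    have h3 := h1 a
    have h4 := h2 a
    refine mul_left_cancel₀ Complex.I_ne_zero ?_
    linear_combination (1 / 2 : ℂ) * h3 - (1 / 2 : ℂ) * h4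
  have i1 := hadd (ν 0) (ν' 2) hm
  have i2 := hadd (ν 1) (ν' 3) hm
  rw [e1, hadd _ _ hm] at i1
  rw [e2, hadd _ _ hm] at i2
  rw [complexIntegral, complexIntegral]
  linear_combination -i1 - Complex.I * i2

/-- The image of a complex density under a map, as a combination of finite measures. -/
def densityMap {X : Type*} [MeasurableSpace X] (ρ : Measure X) (F : X → ℂ) (κ : X → J → ℝ) :
    Fin 4 → Measure (J → ℝ) :=
  ![(ρ.withDensity fun x => ENNReal.ofReal (F x).re).map κ,
    (ρ.withDensity fun x => ENNReal.ofReal (F x).im).map κ,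
    (ρ.withDensity fun x => ENNReal.ofReal (-(F x).re)).map κ,
    (ρ.withDensity fun x => ENNReal.ofReal (-(F x).im)).map κ]

theorem isFiniteMeasure_densityMap {X : Type*} [MeasurableSpace X] {ρ : Measure X} {F : X → ℂ}
    (hF : Integrable F ρ) (κ : X → J → ℝ) (i : Fin 4) : IsFiniteMeasure (densityMap ρ F κ i) := by
  have h : ∀ {G : X → ℝ}, Integrable G ρ →
      IsFiniteMeasure ((ρ.withDensity fun x => ENNReal.ofReal (G x)).map κ) := fun hG => by
    have := isFiniteMeasure_withDensity_ofReal hG.2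
    infer_instance
  fin_cases i
  · exact h hF.re
  · exact h hF.im
  · exact h hF.re.neg
  · exact h hF.im.neg

/-- Truncation at zero in `ENNReal.ofReal` makes the four densities the positive and negative parts
of Re F and Im F, which recombine to F. -/
theorem complexIntegral_densityMap {X : Type*} [MeasurableSpace X] {ρ : Measure X} {F : X → ℂ}
    (hF : Integrable F ρ) {κ : X → J → ℝ} (hκ : Measurable κ) {m : (J → ℝ) → ℂ}
    (hm : IsBoundedMeasurable m) :
    complexIntegral (densityMap ρ F κ) m = ∫ x, m (κ x) * F x ∂ρ := by
  obtain ⟨C, hC⟩ := hm.bounded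
  have h : ∀ {G : X → ℝ}, Integrable G ρ →
      Integrable (fun x => m (κ x) * (max (G x) 0 : ℝ)) ρ ∧
      ∫ k, m k ∂((ρ.withDensity fun x => ENNReal.ofReal (G x)).map κ) =
        ∫ x, m (κ x) * (max (G x) 0 : ℝ) ∂ρ := fun {G} hG => by
    refine ⟨(hG.pos_part.ofReal (𝕜 := ℂ)).bdd_mul
      (hm.measurable.comp hκ).aestronglyMeasurable (Eventually.of_forall fun x => hC (κ x)), ?_⟩
    rw [integral_map hκ.aemeasurable hm.measurable.aestronglyMeasurable,
      integral_withDensity_eq_integral_toReal_smul₀ hG.aestronglyMeasurable.aemeasurable.ennreal_ofReal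
        (Eventually.of_forall fun x => ENNReal.ofReal_lt_top)]
    refine integral_congr_ae (Eventually.of_forall fun x => ?_)
    simp only [ENNReal.toReal_ofReal', Complex.real_smul]
    rw [mul_comm]
  obtain ⟨i0, e0⟩ := h (G := fun x => (F x).re) hF.re
  obtain ⟨i1, e1⟩ := h (G := fun x => (F x).im) hF.im
  obtain ⟨i2, e2⟩ := h (G := fun x => -(F x).re) hF.re.neg
  obtain ⟨i3, e3⟩ := h (G := fun x => -(F x).im) hF.im.neg
  have hsum : complexIntegral (densityMap ρ F κ) m =
      (∫ x, m (κ x) * (max (F x).re 0 : ℝ) ∂ρ - ∫ x, m (κ x) * (max (-(F x).re) 0 : ℝ) ∂ρ) +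
        Complex.I * (∫ x, m (κ x) * (max (F x).im 0 : ℝ) ∂ρ -
          ∫ x, m (κ x) * (max (-(F x).im) 0 : ℝ) ∂ρ) := by
    rw [complexIntegral]
    exact congrArg₂ (· + ·) (congrArg₂ (· - ·) e0 e2)
      (congrArg (Complex.I * ·) (congrArg₂ (· - ·) e1 e3))
  have j0 : Integrable (fun x => m (κ x) * ((max (F x).re 0 : ℝ) : ℂ) -
      m (κ x) * ((max (-(F x).re) 0 : ℝ) : ℂ)) ρ := i0.sub i2
  have j1 : Integrable (fun x => Complex.I * (m (κ x) * ((max (F x).im 0 : ℝ) : ℂ) -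
      m (κ x) * ((max (-(F x).im) 0 : ℝ) : ℂ))) ρ := (i1.sub i3).const_mul _
  rw [hsum, ← integral_sub i0 i2, ← integral_sub i1 i3, ← integral_const_mul, ← integral_add j0 j1]
  refine integral_congr_ae (Eventually.of_forall fun x => ?_)
  have hmax : ∀ r : ℝ, ((max r 0 : ℝ) : ℂ) - ((max (-r) 0 : ℝ) : ℂ) = (r : ℂ) := fun r => by
    rw [← Complex.ofReal_sub, max_zero_sub_max_neg_zero_eq_self]
  simp only [← mul_sub]
  change m (κ x) * (((max (F x).re 0 : ℝ) : ℂ) - ((max (-(F x).re) 0 : ℝ) : ℂ)) + Complex.I *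
    (m (κ x) * (((max (F x).im 0 : ℝ) : ℂ) - ((max (-(F x).im) 0 : ℝ) : ℂ))) = m (κ x) * F x
  rw [hmax, hmax]
  conv_rhs => rw [← Complex.re_add_im (F x)]
  ring

/-- The polarization of the spectral measures. -/
def spectralCombination {H : Type*} [NormedAddCommGroup H] [InnerProductSpace ℂ H]
    [CompleteSpace H] (E : ProjectionValuedMeasure (J → ℝ) H) (x y : H) :
    Fin 4 → Measure (J → ℝ) :=
  ![E.measure (x + y), E.measure (x + Complex.I • y), E.measure (x - y),
    E.measure (x - Complex.I • y)]

theorem complexIntegral_spectralCombination {H : Type*} [NormedAddCommGroup H]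
    [InnerProductSpace ℂ H] [CompleteSpace H] (E : ProjectionValuedMeasure (J → ℝ) H) (x y : H)
    {m : (J → ℝ) → ℂ} (hm : IsBoundedMeasurable m) :
    complexIntegral (spectralCombination E x y) m = 4 * inner ℂ y (E.integral m x) := by
  rw [E.inner_integral_eq hm, complexIntegral]
  simp only [spectralCombination, Matrix.cons_val]
  ring

/-- If `⟨y, m(P) x⟩ = ∫ m(κ) F` for the characters `m` in a dense set, then for all bounded `m`. -/
theorem ProjectionValuedMeasure.inner_integral_eq_integral_of_dense {H : Type*}
    [NormedAddCommGroup H] [InnerProductSpace ℂ H] [CompleteSpace H]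
    (E : ProjectionValuedMeasure (J → ℝ) H) (x y : H) {X : Type*} [MeasurableSpace X]
    {ρ : Measure X} {F : X → ℂ} (hF : Integrable F ρ) {κ : X → J → ℝ} (hκ : Measurable κ)
    {S : Set (J → ℝ)} (hS : Dense S)
    (h : ∀ a ∈ S, inner ℂ y (E.integral (dotPhase a) x) = ∫ z, dotPhase a (κ z) * F z ∂ρ)
    {m : (J → ℝ) → ℂ} (hm : IsBoundedMeasurable m) :
    inner ℂ y (E.integral m x) = ∫ z, m (κ z) * F z ∂ρ := by
  -- The factor 4 compensates the 4⁻¹ of polarization, so that the spectral side is a combination of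
  -- unscaled measures.
  have hF4 := hF.const_mul (4 : ℂ)
  have := isFiniteMeasure_densityMap hF4 κ
  have : ∀ i, IsFiniteMeasure (spectralCombination E x y i) := fun i => by
    fin_cases i
    · exact (inferInstance : IsFiniteMeasure (E.measure (x + y)))
    · exact (inferInstance : IsFiniteMeasure (E.measure (x + Complex.I • y)))
    · exact (inferInstance : IsFiniteMeasure (E.measure (x - y)))
    · exact (inferInstance : IsFiniteMeasure (E.measure (x - Complex.I • y)))
  have h4 : ∀ m : (J → ℝ) → ℂ, ∫ z, m (κ z) * (4 * F z) ∂ρ = 4 * ∫ z, m (κ z) * F z ∂ρ := fun m => by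
    rw [← MeasureTheory.integral_const_mul]
    congr 1
    funext z
    ring
  have key := complexIntegral_eq_of_dense (ν := spectralCombination E x y)
    (ν' := densityMap ρ (fun z => 4 * F z) κ) hS (fun a ha => by
      rw [complexIntegral_spectralCombination E x y (isBoundedMeasurable_dotPhase a),
        complexIntegral_densityMap hF4 hκ (isBoundedMeasurable_dotPhase a), h a ha, h4]) hm
  rw [complexIntegral_spectralCombination E x y hm, complexIntegral_densityMap hF4 hκ hm, h4] at key
  exact mul_left_cancel₀ (by norm_num : (4 : ℂ) ≠ 0) key

end CharacteristicFunctions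

/-! ### Functions of `P` applied to the integrated matrix elements -/

section Soliton

variable {J ι H : Type*} [Fintype J] [NormedAddCommGroup H] [InnerProductSpace ℂ H]
  [CompleteSpace H] {b : HilbertBasis ι ℂ H} {μ : Measure (J → ℝ)}

/-- The scaled displacement `(p' - p) / ε`. -/
def displacement (ε : ℝ) (p p' : J → ℝ) : J → ℝ := ε⁻¹ • (p' - p)

theorem measurable_displacement (ε : ℝ) (p : J → ℝ) : Measurable (displacement ε p) := by
  unfold displacement; fun_prop

theorem dotPhase_displacement (ε : ℝ) (a p p' : J → ℝ) (M : (J → ℝ) → (J → ℝ) → ℂ) :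
    dotPhase a (displacement ε p p') * M p p' =
      phaseKernel (fun p => -ε⁻¹ * ∑ j, a j * p j) M p p' := by
  rw [dotPhase, phaseKernel]
  congr 4
  simp only [displacement, Pi.smul_apply, Pi.sub_apply, smul_eq_mul, Finset.mul_sum,
    ← Finset.sum_sub_distrib, ← Finset.sum_neg_distrib]
  exact Finset.sum_congr rfl fun j _ => by ring

theorem solitonPhase_eq {h : ℝ → (J → ℝ) → ℝ} (hh : IsEigenvalueFamily h) (ε t₀ t : ℝ)
    (p k : J → ℝ) : solitonPhase ε h t₀ t p k = Complex.exp
      ((-ε⁻¹ * (∫ s in t₀..t, h s (p + ε • k)) - -ε⁻¹ * ∫ s in t₀..t, h s p : ℝ) * Complex.I) := by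
  rw [solitonPhase, intervalIntegral.integral_sub (hh.intervalIntegrable _ _ _)
    (hh.intervalIntegrable _ _ _)]
  push_cast
  ring_nf

/-- With k = (p'-p)/ε one has p + εk = p': the soliton phase becomes the phase which the dynamics
puts on the kernel. -/
theorem solitonPhase_displacement {h : ℝ → (J → ℝ) → ℝ} (hh : IsEigenvalueFamily h) {ε : ℝ}
    (hε : ε ≠ 0) (t₀ t : ℝ) (p p' : J → ℝ) (M : (J → ℝ) → (J → ℝ) → ℂ) :
    solitonPhase ε h t₀ t p (displacement ε p p') * M p p' =
      phaseKernel (fun p => -ε⁻¹ * ∫ s in t₀..t, h s p) M p p' := by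
  rw [solitonPhase_eq hh, displacement, smul_smul, mul_inv_cancel₀ hε, one_smul, add_sub_cancel,
    phaseKernel]

theorem isBoundedMeasurable_solitonPhase {h : ℝ → (J → ℝ) → ℝ} (hh : IsEigenvalueFamily h)
    (ε t₀ t : ℝ) (p : J → ℝ) : IsBoundedMeasurable (solitonPhase ε h t₀ t p) := by
  have e := funext (solitonPhase_eq hh ε t₀ t p)
  rw [e]
  refine IsBoundedMeasurable.cexp_ofReal_mul_I ?_
  have h1 : Measurable fun k : J → ℝ => p + ε • k := by fun_prop
  exact (((hh.measurable_integral t₀ t).comp h1).const_mul _).sub_const _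

theorem inner_phase_dot (E : ProjectionValuedMeasure (J → ℝ) H) (a : J → ℝ) (f x : H) :
    inner ℂ (E.phase (measurable_dot a) f) x = inner ℂ f (E.integral (dotPhase a) x) := by
  have h1 := E.integral_conj (IsBoundedMeasurable.cexp_ofReal_mul_I (measurable_dot a))
  have h2 : (fun k : J → ℝ => starRingEnd ℂ (Complex.exp ((∑ j, a j * k j : ℝ) * Complex.I))) =
      dotPhase a := by
    funext k
    rw [dotPhase, ← Complex.exp_conj]
    simp
  rw [h2] at h1
  rw [h1, ContinuousLinearMap.adjoint_inner_right, E.phase_apply]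

/-- The matrix elements of `a(f)`, and the functions of `P` applied to their integrals. -/
theorem KetFamily.IsIntegratedMatrixElement.exists_kernel [SigmaFinite μ] {K : KetFamily μ ι}
    {P : J → H →ₗ.[ℂ] H} {E : ProjectionValuedMeasure (J → ℝ) H} (hE : IsJointSpectralMeasure P E)
    {ε : ℝ} (hε : ε ≠ 0)
    (hP : ∀ j, K.IsGeneralizedEigenfamily (smulGraph ε (secondQuantization b (P j)))
      fun p => p j) {U : Fock ι ≃ₗᵢ[ℂ] Fock ι} (hU : ∀ x, U x = x) {φ : (J → ℝ) → H}
    (hφ : K.IsIntegratedMatrixElement b ε U φ) (f : H) :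
    ∃ M, K.IsMatrixElement (IsAnnihilation b f) M ∧ ∀ᵐ p ∂μ, Integrable (M p) μ ∧
      ∀ m, IsBoundedMeasurable m → inner ℂ f (E.integral m (φ p)) =
        Real.sqrt ε * ∫ p', m (displacement ε p p') * M p p' ∂μ := by
  have hA : IsHeisenbergAnnihilation b U = IsAnnihilation b := by
    funext f x y
    rw [IsHeisenbergAnnihilation, hU, hU]
  have hφ' : ∀ f : H, ∃ M, K.IsMatrixElement (IsAnnihilation b f) M ∧
      ∀ᵐ p ∂μ, Integrable (M p) μ ∧ inner ℂ f (φ p) = Real.sqrt ε * ∫ p', M p p' ∂μ := by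
    rw [← hA]
    exact hφ
  obtain ⟨M, hM, hMi⟩ := hφ' f
  -- Only countably many characters are used, so the exceptional p form one null set. This set is
  -- fixed before m is chosen, which matters because the soliton phase depends on p.
  choose N hN hNi using fun n => hφ' (E.phase (measurable_dot (TopologicalSpace.denseSeq (J → ℝ) n)) f)
  refine ⟨M, hM, ?_⟩
  have h1 := fun n => Measure.ae_ae_of_ae_prod
    (hM.ae_eq_phaseKernel (actsAsPhase_dot hE hε hP (TopologicalSpace.denseSeq (J → ℝ) n)) (hN n))
  filter_upwards [hMi, ae_all_iff.2 hNi, ae_all_iff.2 h1] with p hp hpN hp1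
  refine ⟨hp.1, fun m hm => ?_⟩
  rw [E.inner_integral_eq_integral_of_dense (φ p) f (hp.1.const_mul (Real.sqrt ε : ℂ))
    (measurable_displacement ε p) (TopologicalSpace.denseRange_denseSeq (J → ℝ)) ?_ hm,
    ← integral_const_mul]
  · congr 1
    funext p'
    ring
  · rintro _ ⟨n, rfl⟩
    rw [← inner_phase_dot, (hpN n).2, ← integral_const_mul]
    refine integral_congr_ae ((hp1 n).mono fun p' hp' => ?_)
    have h2 : N n p p' = _ := hp'
    simp only
    rw [h2, mul_left_comm, dotPhase_displacement]
    rfl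

end Soliton
end

/-! ### The soliton formula -/

theorem proposition5
    {J ι H : Type*} [Fintype J] [Countable ι]
    [NormedAddCommGroup H] [InnerProductSpace ℂ H] [CompleteSpace H]
    (b : HilbertBasis ι ℂ H)
    (ε : ℝ) (hε : 0 < ε)
    (P : J → H →ₗ.[ℂ] H) (E : ProjectionValuedMeasure (J → ℝ) H)
    (hE : IsJointSpectralMeasure P E)
    (Φ : Submodule ℂ H) (hΦ : Dense (Φ : Set H))
    (W : ℝ → ∀ m, ParticleOperator b Φ m)
    (t₀ : ℝ) (U : ℝ → Fock ι ≃ₗᵢ[ℂ] Fock ι)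
    (hU : IsPropagator (fun t => uniformizedHamiltonian b ε (W t)) t₀ U)
    (μ : Measure (J → ℝ)) [SigmaFinite μ] (K : KetFamily μ ι)
    (h : ℝ → (J → ℝ) → ℝ)
    (hmeas : ∀ t, Measurable (h t)) (hcont : ∀ p, Continuous fun t => h t p)
    (hbdd : ∀ R : ℝ, ∃ C : ℝ, ∀ t p, |t| ≤ R → ‖p‖ ≤ R → |h t p| ≤ C)
    (hP : ∀ j, K.IsGeneralizedEigenfamily (smulGraph ε (secondQuantization b (P j)))
      fun p => p j)
    (hH : ∀ t, K.IsGeneralizedEigenfamily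
      (smulGraph ε (uniformizedHamiltonian b ε (W t))) (h t))
    (φ : (J → ℝ) → H) (hφ : K.IsIntegratedMatrixElement b ε (U t₀) φ)
    (t : ℝ) (ψ : (J → ℝ) → H) :
    K.IsIntegratedMatrixElement b ε (U t) ψ ↔
      ∀ᵐ p ∂μ, ψ p = E.integral (solitonPhase ε h t₀ t p) (φ p) := by
  have hh : IsEigenvalueFamily h := ⟨hmeas, hcont, hbdd⟩
  have hθ : Measurable fun p => -ε⁻¹ * ∫ s in t₀..t, h s p :=
    (hh.measurable_integral t₀ t).const_mul _
  have hUt : ∀ g, U t (K.packet g) = K.packet (phaseAmplitude hθ g) :=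
    K.propagator_packet hh hε.ne' hU hH t
  have key := fun f => hφ.exists_kernel hE hε.ne' hP hU.1 f
  have hval : ∀ (f : H) (M : (J → ℝ) → (J → ℝ) → ℂ) (p : J → ℝ),
      (∀ m, IsBoundedMeasurable m → inner ℂ f (E.integral m (φ p)) =
        Real.sqrt ε * ∫ p', m (displacement ε p p') * M p p' ∂μ) →
      inner ℂ f (E.integral (solitonPhase ε h t₀ t p) (φ p)) =
        Real.sqrt ε * ∫ p', phaseKernel (fun p => -ε⁻¹ * ∫ s in t₀..t, h s p) M p p' ∂μ := by
    intro f M p hM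
    rw [hM _ (isBoundedMeasurable_solitonPhase hh ε t₀ t p)]
    simp only [solitonPhase_displacement hh hε.ne']
  constructor
  · intro hψ
    -- The exceptional set depends on the component, so the comparison is made along the countable
    -- basis.
    have hb : ∀ i, ∀ᵐ p ∂μ, inner ℂ (b i) (ψ p) =
        inner ℂ (b i) (E.integral (solitonPhase ε h t₀ t p) (φ p)) := by
      intro i
      obtain ⟨M, hM, hMi⟩ := key (b i)
      obtain ⟨N, hN, hNi⟩ := hψ (b i)
      -- The Heisenberg operator is single-valued because `U t` is injective, so its kernel is
      -- unique almost everywhere and agrees with the phased one.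
      have h1 := Measure.ae_ae_of_ae_prod (KetFamily.IsMatrixElement.ae_eq
        (fun x y y' hy hy' => (U t).injective (hy.unique hy')) hN (hM.heisenberg hθ hUt))
      filter_upwards [hMi, hNi, h1] with p hp hpN hp1
      rw [hpN.2, hval _ M p hp.2]
      congr 1
      exact integral_congr_ae hp1
    filter_upwards [ae_all_iff.2 hb] with p hp
    refine b.repr.injective (lp.ext (funext fun i => ?_))
    rw [b.repr_apply_apply, b.repr_apply_apply, hp]
  · intro hψ f
    -- Existence at time t: a phase of modulus one changes neither the measurability nor the
    -- integrability of the kernel at t₀.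
    obtain ⟨M, hM, hMi⟩ := key f
    refine ⟨_, hM.heisenberg hθ hUt, ?_⟩
    filter_upwards [hMi, hψ] with p hp hpψ
    exact ⟨hp.1.phaseKernel hθ, by rw [hpψ, hval f M p hp.2]⟩
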